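/- Let $S$ be a connected (second countable, Hausdorff) smooth manifold with a smooth affine connection $\nabla$ which is curvature-free, i.e. there are $\dim S$ $\nabla$-parallel vector fields on $S$ that are linearly independent at every point. (A smooth vector field $X$ on $S$ is $\nabla$-parallel if $\nabla_Y X=0$ for every smooth vector field $Y$ on $S$.) For $p,q\in S$ let $\Pi_{p,q}:T_pS\to T_qS$ be the parallel transport, i.e. the linear isomorphism with $\Pi_{p,q}(X_p)=X_q$ for every $\nabla$-parallel vector field $X$. Let $\mathcal V: p\mapsto V_p\subset T_pS$ be an $n$-dimensional $\nabla$-parallel distribution, i.e. $\dim V_p=n$ and $\Pi_{p,q}(V_p)=V_q$ for all $p,q\in S$. Denote by $\mathfrak X(S:\mathcal V)$ the set of smooth vector fields $X$ on $S$ with $X_p\in V_p$ for all $p\in S$, and by $\mathfrak X_{\nabla\text{-par}}(S:\mathcal V)$ the set of those $X\in\mathfrak X(S:\mathcal V)$ that are $\nabla$-parallel. Then the following conditions are equivalent. (i) For every $p\in S$ there is a $\nabla$-autoparallel embedded submanifold $M$ of $S$ (not required to be closed or maximal) with $p\in M$ and $T_pM=V_p$. Here $M$ is $\nabla$-autoparallel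 if for all smooth vector fields $X,Y$ on $M$ the field $\nabla_XY$ along $M$, defined by the connection that $\nabla$ induces on sections of $TS|_M$, is tangent to $M$. (ii) $\mathcal V$ is involutive: $[X,Y]\in\mathfrak X(S:\mathcal V)$ for all $X,Y\in\mathfrak X(S:\mathcal V)$. (iii) $[X,Y]\in\mathfrak X(S:\mathcal V)$ for all $X,Y\in\mathfrak X_{\nabla\text{-par}}(S:\mathcal V)$. (iv) The torsion $T(X,Y)=\nabla_XY-\nabla_YX-[X,Y]$ of $\nabla$ satisfies $T_p(V_p\times V_p)\subset V_p$ for every $p\in S$. -/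

import Mathlib

open scoped Manifold ContDiff Topology

noncomputable section

namespace AutoparallelDist

variable {m : ℕ} {S : Type*} [TopologicalSpace S] [ChartedSpace (EuclideanSpace ℝ (Fin m)) S]
  [IsManifold (𝓡 m) ∞ S]

/-- An affine connection on `S`: a covariant derivative on the tangent bundle.
`cov Y p (X p)` is the value of `∇_X Y` at `p`. Its smoothness is the separate class
`CovariantDerivative.ContMDiffCovariantDerivative cov ∞`. -/
abbrev AffineConnection (m : ℕ) (S : Type*) [TopologicalSpace S]
    [ChartedSpace (EuclideanSpace ℝ (Fin m)) S] [IsManifold (𝓡 m) ∞ S] :=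
  CovariantDerivative (𝓡 m) (EuclideanSpace ℝ (Fin m)) (TangentSpace (𝓡 m) : S → Type _)

/-- The smooth vector fields on a manifold `S` of dimension `m`. -/
def smoothVF (m : ℕ) (S : Type*) [TopologicalSpace S]
    [ChartedSpace (EuclideanSpace ℝ (Fin m)) S] [IsManifold (𝓡 m) ∞ S] :
    Set (Π p : S, TangentSpace (𝓡 m) p) :=
  {X | ContMDiff (𝓡 m) (𝓡 m).tangent ∞ fun p ↦ (⟨p, X p⟩ : TangentBundle (𝓡 m) S)}

/-- The `∇`-parallel smooth vector fields on `S`. -/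
def parallelVF (cov : AffineConnection m S) : Set (Π p : S, TangentSpace (𝓡 m) p) :=
  {X | X ∈ smoothVF m S ∧ ∀ Y ∈ smoothVF m S, ∀ p, cov X p (Y p) = 0}

/-- `∇` is curvature-free: there are `dim S` parallel vector fields which are linearly independent
(at every point). -/
def IsCurvatureFree (cov : AffineConnection m S) : Prop :=
  ∃ X : Fin m → Π p : S, TangentSpace (𝓡 m) p,
    (∀ i, X i ∈ parallelVF cov) ∧ ∀ p, LinearIndependent ℝ fun i ↦ X i p

/-- `w ∈ T_q S` is the parallel transport of `v ∈ T_p S`: some parallel vector field takes the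
values `v` at `p` and `w` at `q`. For a curvature-free connection on a connected manifold, this is
the graph of a linear isomorphism from `T_p S` to `T_q S`. -/
def IsParallelTransport (cov : AffineConnection m S) (p q : S)
    (v : TangentSpace (𝓡 m) p) (w : TangentSpace (𝓡 m) q) : Prop :=
  ∃ X ∈ parallelVF cov, X p = v ∧ X q = w

/-- The distribution `V` is parallel: parallel transport from `p` to `q` maps `V p` onto `V q`. -/
def IsParallelDistribution (cov : AffineConnection m S)
    (V : Π p : S, Submodule ℝ (TangentSpace (𝓡 m) p)) : Prop :=
  ∀ p q, {w | ∃ v ∈ V p, IsParallelTransport cov p q v w} = (V q : Set (TangentSpace (𝓡 m) q))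

/-- The smooth vector fields on `S` with values in the distribution `V`. -/
def smoothVFIn (V : Π p : S, Submodule ℝ (TangentSpace (𝓡 m) p)) :
    Set (Π p : S, TangentSpace (𝓡 m) p) :=
  {X | X ∈ smoothVF m S ∧ ∀ p, X p ∈ V p}

/-- The parallel vector fields on `S` with values in the distribution `V`. -/
def parallelVFIn (cov : AffineConnection m S) (V : Π p : S, Submodule ℝ (TangentSpace (𝓡 m) p)) :
    Set (Π p : S, TangentSpace (𝓡 m) p) :=
  smoothVFIn V ∩ parallelVF cov

/-- The trivialization of the tangent bundle around `p` (given by the preferred chart at `p`). -/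
abbrev tangentTriv (p : S) : Bundle.Trivialization (EuclideanSpace ℝ (Fin m))
    (Bundle.TotalSpace.proj : TangentBundle (𝓡 m) S → S) :=
  trivializationAt (EuclideanSpace ℝ (Fin m)) (TangentSpace (𝓡 m) : S → Type _) p

section Induced

variable {n : ℕ} {M : Type*} [TopologicalSpace M] [ChartedSpace (EuclideanSpace ℝ (Fin n)) M]

/-- The connection induced along a map `f : M → S`, acting on fields `Y` of tangent vectors of `S`
along `f`: `(∇_X Y)_q`, where `X` only enters through its value `x ∈ T_q M`. In the local frame
`e_i` of `TS` given by the trivialization around `f q`, and with `Y = ∑ y^i (e_i ∘ f)`, this is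
`∑ dy^i(x) e_i (f q) + ∇_{df(x)} (∑ y^i(q) e_i)`. -/
def covAlong (cov : AffineConnection m S) (f : M → S)
    (Y : Π q : M, TangentSpace (𝓡 m) (f q)) (q : M) (x : TangentSpace (𝓡 n) q) :
    TangentSpace (𝓡 m) (f q) :=
  let τ := tangentTriv (f q)
  let y : M → EuclideanSpace ℝ (Fin m) := fun q' ↦ (τ ⟨f q', Y q'⟩).2
  τ.symmL ℝ (f q) (mvfderiv (𝓡 n) y q x)
    + cov (FiberBundle.extend (EuclideanSpace ℝ (Fin m)) (Y q)) (f q)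
        (mfderiv (𝓡 n) (𝓡 m) f q x)

end Induced

/-- The differential at `p` of the coordinates of a vector field in the trivialization at `p`. -/
def coordD (σ : Π p : S, TangentSpace (𝓡 m) p) (p : S) :
    TangentSpace (𝓡 m) p →L[ℝ] EuclideanSpace ℝ (Fin m) :=
  mvfderiv (𝓡 m) (fun p' ↦ ((tangentTriv p) ⟨p', σ p'⟩).2) p

lemma mvfderiv_congr {f g : S → EuclideanSpace ℝ (Fin m)} {p : S}
   (h : f =ᶠ[𝓝 p] g) :
   mvfderiv (𝓡 m) f p = mvfderiv (𝓡 m) g p := by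
  unfold mvfderiv
  rw [h.mfderiv_eq]
  congr!

lemma coordD_extend (p : S) (v : TangentSpace (𝓡 m) p) :
   coordD (FiberBundle.extend (EuclideanSpace ℝ (Fin m)) v) p = 0 := by
  have : (fun p' ↦ ((tangentTriv p)
      ⟨p', FiberBundle.extend (EuclideanSpace ℝ (Fin m)) v p'⟩).2) =ᶠ[𝓝 p] fun _ ↦ ((tangentTriv p)
      ⟨p, v⟩).2 := by
    set τ := tangentTriv (m := m) p
    filter_upwards [τ.open_baseSet.mem_nhds (FiberBundle.mem_baseSet_trivializationAt' p)] with p' hp'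
    rw [FiberBundle.extend, τ.apply_mk_symm hp']
  unfold coordD
  rw [mvfderiv_congr this, mvfderiv_const]

lemma coord_diff (σ : Π p : S, TangentSpace (𝓡 m) p) (p : S)
   (h : MDifferentiableAt (𝓡 m) (𝓡 m).tangent (fun p ↦ (⟨p, σ p⟩ : TangentBundle (𝓡 m) S)) p) :
     MDifferentiableAt (𝓡 m) 𝓘(ℝ, EuclideanSpace ℝ (Fin m)) (fun p' ↦ ((tangentTriv p) ⟨p', σ p'⟩).2) p :=
   ((tangentTriv p).mdifferentiableAt_section_iff (𝓡 m) σ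
     (FiberBundle.mem_baseSet_trivializationAt' p)).1 h

lemma tensorialAt_sub (cov : AffineConnection m S) (p : S) (u : TangentSpace (𝓡 m) p) :
    TensorialAt (𝓡 m) (EuclideanSpace ℝ (Fin m)) (fun σ : Π p : S, TangentSpace (𝓡 m) p ↦
      cov σ p u - (tangentTriv p).symmL ℝ p
        (coordD σ p u)) p := by
  set τ := tangentTriv (m := m) p with hτ
  have hp : p ∈ τ.baseSet := FiberBundle.mem_baseSet_trivializationAt' p
  constructor
  · intro g σ hg hσ
    have e : (fun p' ↦ (τ ⟨p', (g • σ) p'⟩).2) =ᶠ[𝓝 p] g • fun p' ↦ (τ ⟨p', σ p'⟩).2 := by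
      filter_upwards [τ.open_baseSet.mem_nhds hp] with p' hp'
      exact (τ.linear ℝ hp').map_smul (g p') (σ p')
    have h3 : coordD (g • σ) p = _ :=
      (mvfderiv_congr e).trans (mvfderiv_smul hg (coord_diff _ _ hσ))
    have h4 : mvfderiv (𝓡 m) (fun p' ↦ (τ ⟨p', σ p'⟩).2) p = coordD σ p := rfl
    have : τ.symmL ℝ p (τ ⟨p, σ p⟩).2 = σ p := by
      have := τ.symmL_continuousLinearMapAt (R := ℝ) hp (σ p)
      rwa [Bundle.Trivialization.continuousLinearMapAt_apply, τ.coe_linearMapAt_of_mem hp] at this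
    rw [cov.isCovariantDerivativeOn.leibniz hσ hg, h3, h4]
    have h5 : τ.symmL ℝ p ((g p • coordD σ p + (mvfderiv (𝓡 m) g p).smulRight (τ ⟨p, σ p⟩).2) u) =
        g p • τ.symmL ℝ p (coordD σ p u) + (mvfderiv (𝓡 m) g p u) • σ p := by
      rw [← this]
      simp [this]
    rw [h5]
    simp only [add_apply, smul_apply, ContinuousLinearMap.smulRight_apply]
    module
  · intro σ σ' hσ hσ'
    have e : (fun p' ↦ (τ ⟨p', (σ + σ') p'⟩).2) =ᶠ[𝓝 p] (fun p' ↦ (τ ⟨p', σ p'⟩).2) +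
        fun p' ↦ (τ ⟨p', σ' p'⟩).2 := by
      filter_upwards [τ.open_baseSet.mem_nhds hp] with p' hp'
      exact (τ.linear ℝ hp').map_add (σ p') (σ' p')
    have h3 : coordD (σ + σ') p = coordD σ p + coordD σ' p :=
      (mvfderiv_congr e).trans (mvfderiv_add (coord_diff _ _ hσ) (coord_diff _ _ hσ'))
    rw [cov.isCovariantDerivativeOn.add hσ hσ', h3]
    simp only [add_apply, map_add]
    abel

/-- The induced connection along `f` agrees with `∇` on restrictions of vector fields:
`∇_x (Z ∘ f) = ∇_{df(x)} Z`. -/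
theorem covAlong_comp {n : ℕ} {M : Type*} [TopologicalSpace M]
    [ChartedSpace (EuclideanSpace ℝ (Fin n)) M] (cov : AffineConnection m S) (f : M → S)
    (Z : Π p : S, TangentSpace (𝓡 m) p) (q : M)
   (hf : MDifferentiableAt (𝓡 n) (𝓡 m) f q)
   (h : MDifferentiableAt (𝓡 m) (𝓡 m).tangent (fun p ↦ (⟨p, Z p⟩ : TangentBundle (𝓡 m) S)) (f q))
    (x : TangentSpace (𝓡 n) q) :
   covAlong cov f (fun q' ↦ Z (f q')) q x = cov Z (f q) (mfderiv (𝓡 n) (𝓡 m) f q x) := by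
  have := (tensorialAt_sub cov (f q) (mfderiv (𝓡 n) (𝓡 m) f q x)).pointwise h
    (FiberBundle.mdifferentiableAt_extend (I := 𝓡 m) (F := EuclideanSpace ℝ (Fin m)) (Z (f q))) (by simp)
  simp only [coordD_extend] at this
  let g : S → EuclideanSpace ℝ (Fin m) := fun p' ↦ ((tangentTriv (f q)) ⟨p', Z p'⟩).2
  have e : mvfderiv (𝓡 n) (g ∘ f) q x = mvfderiv (𝓡 m) g (f q) (mfderiv (𝓡 n) (𝓡 m) f q x) := by
    have := mfderiv_comp q (coord_diff Z (f q) h) hf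
    exact congrArg (fun L ↦ L x) this
  unfold covAlong
  dsimp only
  have h2 := sub_eq_iff_eq_add.1 this
  rw [h2]
  simp
  rw [add_comm]
  congr 2

/-- A subset `M` of `S`, with a differentiable structure of dimension `n` on the subspace `M`, is an
(embedded) submanifold of `S`: the inclusion is a smooth embedding. -/
def IsSubmanifold (m n : ℕ) {S : Type*} [TopologicalSpace S]
    [ChartedSpace (EuclideanSpace ℝ (Fin m)) S] (M : Set S)
    [ChartedSpace (EuclideanSpace ℝ (Fin n)) M] : Prop :=
  Manifold.IsSmoothEmbedding (𝓡 n) (𝓡 m) ∞ (Subtype.val : M → S)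

/-- The tangent space of the submanifold `M` at `q`, as a subspace of the tangent space of `S`. -/
def tangentOf (m n : ℕ) {S : Type*} [TopologicalSpace S]
    [ChartedSpace (EuclideanSpace ℝ (Fin m)) S] (M : Set S)
    [ChartedSpace (EuclideanSpace ℝ (Fin n)) M] (q : M) :
    Submodule ℝ (TangentSpace (𝓡 m) (q : S)) :=
  LinearMap.range (mfderiv (𝓡 n) (𝓡 m) (Subtype.val : M → S) q).toLinearMap

/-- The submanifold `M` of `S` is autoparallel: for all smooth vector fields `X`, `Y` on `M`, the
field `∇_X Y` (along the inclusion) is tangent to `M`. -/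
def IsAutoparallel (cov : AffineConnection m S) (n : ℕ) (M : Set S)
    [ChartedSpace (EuclideanSpace ℝ (Fin n)) M] [IsManifold (𝓡 n) ∞ M] : Prop :=
  ∀ X ∈ smoothVF n M, ∀ Y ∈ smoothVF n M, ∀ q : M,
    covAlong cov (Subtype.val : M → S)
      (fun q' ↦ mfderiv (𝓡 n) (𝓡 m) (Subtype.val : M → S) q' (Y q')) q (X q) ∈ tangentOf m n M q

end AutoparallelDist

end

/-! In a global parallel frame, a parallel distribution is a constant subspace `V₀` of coefficient
vectors (`exists_eq_map_frameMap`). A field in `V` has the form `∑ c^i X_i` with `c` valued in `V₀`.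
Since the `X_i` are parallel, its covariant derivative along `x` is `∑ dc^i(x) X_i`, which is again
in `V`. This holds on `S` (`cov_mem`) and along any differentiable map into `S` (`covAlong_mem`).

Two consequences follow. The identity `[Y, Z] = ∇_Y Z - ∇_Z Y - T(Y, Z)` turns invariance of `V`
under torsion into involutivity. Every integral manifold of `V` is autoparallel. Conversely, on an
autoparallel submanifold the torsion of two tangent vectors is a difference of two tangent
derivatives (`torsion_mfderiv`), hence tangent; the tangency condition is needed only at the chosen
point.

The remaining implication, from brackets of parallel fields to integral manifolds, is the Frobenius
theorem. It is proved here by solving `Df = A ∘ f` along rays (`exists_hasFDerivAt_eq_of_symm`),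
with `A` the basis of the distribution normalised by a linear projection
(`exists_integral_section`). The image of `f` is then flattened into a slice of a chart
(`straighten`, `exists_slice`). -/

noncomputable section

namespace AutoparallelDist

/-! ### Total differential equations `Df = A ∘ f`. -/

section Frobenius

open Set Metric
open scoped NNReal

variable {E F : Type*} [NormedAddCommGroup E] [NormedSpace ℝ E]
  [NormedAddCommGroup F] [NormedSpace ℝ F]

/-- Second order Taylor estimate on a convex set, for a map with Lipschitz derivative. -/
lemma norm_sub_sub_fderiv_le {G : Type*} [NormedAddCommGroup G] [NormedSpace ℝ G]
    {A : F → G} {B : Set F} (hB : Convex ℝ B) {K : ℝ≥0}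
    (hd : ∀ z ∈ B, DifferentiableAt ℝ A z) (hK : LipschitzOnWith K (fderiv ℝ A) B)
    {z w : F} (hz : z ∈ B) (hw : w ∈ B) :
    ‖A w - A z - fderiv ℝ A z (w - z)‖ ≤ K * ‖w - z‖ ^ 2 := by
  have hs : segment ℝ z w ⊆ B := hB.segment_subset hz hw
  have := (convex_segment z w).norm_image_sub_le_of_norm_hasFDerivWithin_le'
    (f := A) (f' := fderiv ℝ A) (φ := fderiv ℝ A z) (C := K * ‖w - z‖)
    (fun y hy ↦ (hd y (hs hy)).hasFDerivAt.hasFDerivWithinAt) (fun y hy ↦ by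
      have h1 := hK.dist_le_mul y (hs hy) z hz
      rw [dist_eq_norm, dist_eq_norm] at h1
      refine h1.trans ?_
      gcongr
      exact norm_sub_le_of_mem_segment hy)
    (left_mem_segment ℝ z w) (right_mem_segment ℝ z w)
  rw [pow_two, ← mul_assoc]
  exact this

/-- The solution at time `1` of the radial equation `u' = A(u) x` depends differentiably on `x`,
with derivative `A(u)`, when `A` satisfies the integrability condition of Frobenius. -/
lemma norm_radial_solution_sub_le {A : F → E →L[ℝ] F} {z₀ : F} {a r : ℝ} {L K K' N : ℝ≥0}
    (hd : ∀ z ∈ closedBall z₀ a, DifferentiableAt ℝ A z)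
    (hL : ∀ z ∈ closedBall z₀ a, ‖A z‖ ≤ L)
    (hK : LipschitzOnWith K A (closedBall z₀ a))
    (hN : ∀ z ∈ closedBall z₀ a, ‖fderiv ℝ A z‖ ≤ N)
    (hK' : LipschitzOnWith K' (fderiv ℝ A) (closedBall z₀ a))
    (hsymm : ∀ z ∈ closedBall z₀ a, ∀ v w, fderiv ℝ A z (A z v) w = fderiv ℝ A z (A z w) v)
    (hr : 0 < r) (hrL : L * r ≤ a / 2) {x h : E} (hx : ‖x‖ < r) (hxh : ‖x + h‖ < r) (hh : ‖h‖ < r)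
    {u w : ℝ → F} (hu0 : u 0 = z₀) (hw0 : w 0 = z₀)
    (hu : ∀ t ∈ Icc (0 : ℝ) 1, HasDerivWithinAt u (A (u t) x) (Icc 0 1) t)
    (hw : ∀ t ∈ Icc (0 : ℝ) 1, HasDerivWithinAt w (A (w t) (x + h)) (Icc 0 1) t)
    (hua : ∀ t ∈ Icc (0 : ℝ) 1, u t ∈ closedBall z₀ (L * ‖x‖))
    (hwa : ∀ t ∈ Icc (0 : ℝ) 1, w t ∈ closedBall z₀ (L * ‖x + h‖)) :
    ‖w 1 - u 1 - A (u 1) h‖ ≤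
      (K' * L ^ 2 * r + N * L) * (Real.exp (K * r + 1) / (K * r + 1)) * ‖h‖ ^ 2 := by
  have ha : 0 ≤ a := by
    have : 0 ≤ L * r := by positivity
    linarith
  have hsub : ∀ {y : E}, ‖y‖ < r → L * ‖y‖ ≤ a / 2 := fun hy ↦
    (mul_le_mul_of_nonneg_left hy.le L.2).trans hrL
  have huB : ∀ t ∈ Icc (0 : ℝ) 1, u t ∈ closedBall z₀ a := fun t ht ↦
    closedBall_subset_closedBall ((hsub hx).trans (by linarith)) (hua t ht)
  have hwB : ∀ t ∈ Icc (0 : ℝ) 1, w t ∈ closedBall z₀ a := fun t ht ↦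
    closedBall_subset_closedBall ((hsub hxh).trans (by linarith)) (hwa t ht)
  have hk : ∀ t ∈ Icc (0 : ℝ) 1, ‖t • A (u t) h‖ ≤ L * ‖h‖ := fun t ht ↦ by
    rw [norm_smul, Real.norm_eq_abs, abs_of_nonneg ht.1]
    calc t * ‖A (u t) h‖ ≤ 1 * ‖A (u t) h‖ := by gcongr; exact ht.2
      _ ≤ L * ‖h‖ := by rw [one_mul]; exact (A (u t)).le_of_opNorm_le (hL _ (huB t ht)) h
  -- First-order guess for the solution in direction `x + h`. It solves that equation up to `O(‖h‖ ^
  -- 2)`, so Grönwall's inequality compares it with `w`.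
  set φ : ℝ → F := fun t ↦ u t + t • A (u t) h with hφ
  have hφB : ∀ t ∈ Icc (0 : ℝ) 1, φ t ∈ closedBall z₀ a := fun t ht ↦ by
    have h1 := mem_closedBall_iff_norm.1 (hua t ht)
    rw [mem_closedBall_iff_norm]
    calc ‖u t + t • A (u t) h - z₀‖ = ‖(u t - z₀) + t • A (u t) h‖ := by congr 1; abel
      _ ≤ L * ‖x‖ + L * ‖h‖ := (norm_add_le _ _).trans (add_le_add h1 (hk t ht))
      _ ≤ a := by linarith [hsub hx, hsub hh]
  set φ' : ℝ → F := fun t ↦ A (u t) x + (A (u t) h + t • fderiv ℝ A (u t) (A (u t) x) h)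
  have hφd : ∀ t ∈ Icc (0 : ℝ) 1, HasDerivWithinAt φ (φ' t) (Icc 0 1) t := fun t ht ↦ by
    have h1 : HasDerivWithinAt (fun t ↦ A (u t)) (fderiv ℝ A (u t) (A (u t) x)) (Icc 0 1) t :=
      (hd _ (huB t ht)).hasFDerivAt.comp_hasDerivWithinAt t (hu t ht)
    have h2 := (hasDerivWithinAt_id t (Icc (0 : ℝ) 1)).fun_smul
      (h1.clm_apply (hasDerivWithinAt_const t _ h))
    refine ((hu t ht).fun_add h2).congr_deriv ?_
    simp [φ']
    abel
  have hIci : ∀ {g : ℝ → F} {g' : F} {t : ℝ}, t ∈ Ico (0 : ℝ) 1 →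
      HasDerivWithinAt g g' (Icc 0 1) t → HasDerivWithinAt g g' (Ici t) t := fun ht hg ↦
    hg.mono_of_mem_nhdsWithin (Icc_mem_nhdsGE_of_mem ht)
  -- The summand `1` keeps the Lipschitz constant nonzero, as the closed form of the Grönwall bound
  -- requires.
  have hv : ∀ t ∈ Ico (0 : ℝ) 1, LipschitzOnWith (K * r.toNNReal + 1)
      (fun z ↦ A z (x + h)) (closedBall z₀ a) := fun t _ ↦ by
    refine LipschitzOnWith.of_dist_le_mul fun y hy z hz ↦ ?_
    have h1 := hK.dist_le_mul y hy z hz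
    rw [dist_eq_norm] at h1 ⊢
    rw [← sub_apply]
    refine ((A y - A z).le_of_opNorm_le h1 _).trans ?_
    push_cast
    rw [Real.coe_toNNReal r hr.le]
    calc K * dist y z * ‖x + h‖ ≤ K * dist y z * r := by gcongr
      _ ≤ (K * r + 1) * dist y z := by nlinarith [dist_nonneg (x := y) (y := z)]
  have hbound : ∀ t ∈ Ico (0 : ℝ) 1,
      dist (φ' t) (A (φ t) (x + h)) ≤ (K' * L ^ 2 * r + N * L) * ‖h‖ ^ 2 := fun t ht' ↦ by
    have ht := Ico_subset_Icc_self ht'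
    set k := t • A (u t) h with hkdef
    have e1 : φ t - u t = k := by simp [hφ, hkdef]
    have hT := norm_sub_sub_fderiv_le (convex_closedBall z₀ a) hd hK' (huB t ht) (hφB t ht)
    rw [e1] at hT
    -- By integrability `t • DA(A x) h = DA(k) x`. The terms of first order in `h` therefore cancel,
    -- leaving a Taylor remainder and `DA(k) h`, both quadratic in `h`.
    have e2 : φ' t - A (φ t) (x + h) =
        -((A (φ t) - A (u t) - fderiv ℝ A (u t) k) (x + h) + fderiv ℝ A (u t) k h) := by
      simp only [φ', hkdef, hsymm _ (huB t ht) x h, map_smul, sub_apply,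
        smul_apply, map_add]
      abel
    rw [dist_eq_norm, e2, norm_neg]
    have hk' := hk t ht
    calc _ ≤ K' * ‖k‖ ^ 2 * ‖x + h‖ + N * ‖k‖ * ‖h‖ := by
          refine (norm_add_le _ _).trans (add_le_add ?_ ?_)
          · exact ContinuousLinearMap.le_of_opNorm_le _ hT _
          · exact ContinuousLinearMap.le_of_opNorm_le _
              (ContinuousLinearMap.le_of_opNorm_le _ (hN _ (huB t ht)) _) _
      _ ≤ K' * (L * ‖h‖) ^ 2 * r + N * (L * ‖h‖) * ‖h‖ := by gcongr
      _ = _ := by ring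
  have key := dist_le_of_approx_trajectories_ODE_of_mem (s := fun _ ↦ closedBall z₀ a)
    (v := fun _ z ↦ A z (x + h)) (δ := 0) (εf := 0) (f' := fun t ↦ A (w t) (x + h)) hv
    (fun t ht ↦ (hw t ht).continuousWithinAt)
    (fun t ht ↦ hIci ht (hw t (Ico_subset_Icc_self ht))) (fun t _ ↦ (dist_self _).le)
    (fun t ht ↦ hwB t (Ico_subset_Icc_self ht))
    (fun t ht ↦ (hφd t ht).continuousWithinAt)
    (fun t ht ↦ hIci ht (hφd t (Ico_subset_Icc_self ht))) hbound
    (fun t ht ↦ hφB t (Ico_subset_Icc_self ht)) (by simp [hφ, hu0, hw0]) 1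
    (right_mem_Icc.2 zero_le_one)
  rw [dist_eq_norm, sub_zero, zero_add] at key
  have hpos : (0 : ℝ) < K * r + 1 := by positivity
  rw [gronwallBound_of_K_ne_0 (by push_cast; positivity)] at key
  push_cast at key
  rw [Real.coe_toNNReal r hr.le] at key
  simp only [hφ, one_smul, zero_mul, zero_add, mul_one, ← sub_sub] at key
  refine key.trans ?_
  have hc : 0 ≤ (K' * L ^ 2 * r + N * L) * ‖h‖ ^ 2 / (K * r + 1) := by positivity
  calc _ ≤ (K' * L ^ 2 * r + N * L) * ‖h‖ ^ 2 / (K * r + 1) * Real.exp (K * r + 1) := by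
        gcongr
        linarith
    _ = _ := by ring

/-- A radial solution, on the unit interval. -/
lemma exists_radial_solution [CompleteSpace F] {A : F → E →L[ℝ] F} {z₀ : F} {a : ℝ} {L K : ℝ≥0}
    (hL : ∀ z ∈ closedBall z₀ a, ‖A z‖ ≤ L)
    (hK : LipschitzOnWith K A (closedBall z₀ a)) {x : E} (hx : L * ‖x‖ ≤ a) :
    ∃ u : ℝ → F, u 0 = z₀ ∧
      (∀ t ∈ Icc (0 : ℝ) 1, HasDerivWithinAt u (A (u t) x) (Icc 0 1) t) ∧
      ∀ t ∈ Icc (0 : ℝ) 1, u t ∈ closedBall z₀ (L * ‖x‖) := by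
  have hsub : closedBall z₀ (L * ‖x‖) ⊆ closedBall z₀ a := closedBall_subset_closedBall hx
  -- The radius `L * ‖x‖` is the speed bound times the duration `1`, so the fixed point exists on
  -- the whole interval and stays in this smaller ball.
  have hP : IsPicardLindelof (fun _ z ↦ A z x) (tmin := 0) (tmax := 1)
      ⟨0, left_mem_Icc.2 zero_le_one⟩ z₀ (L * ‖x‖₊) 0 (L * ‖x‖₊) (K * ‖x‖₊) := by
    refine IsPicardLindelof.of_time_independent (fun z hz ↦ ?_) ?_ ?_
    · push_cast
      exact (A z).le_of_opNorm_le (hL z (hsub (by simpa using hz))) x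
    · refine LipschitzOnWith.of_dist_le_mul fun y hy z hz ↦ ?_
      have h1 := hK.dist_le_mul y (hsub (by simpa using hy)) z (hsub (by simpa using hz))
      rw [dist_eq_norm] at h1 ⊢
      rw [← sub_apply]
      refine ((A y - A z).le_of_opNorm_le h1 _).trans (le_of_eq ?_)
      push_cast
      ring
    · simp
  obtain ⟨α, hα⟩ := ODE.FunSpace.exists_isFixedPt_next hP (mem_closedBall_self le_rfl)
  have hmem : ∀ t, α.compProj t ∈ closedBall z₀ (L * ‖x‖) := fun t ↦ by
    simpa using α.compProj_mem_closedBall hP.mul_max_le (t := t)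
  refine ⟨α.compProj, ?_, fun t ht ↦ ?_, fun t _ ↦ hmem t⟩
  · have : α.compProj ((⟨0, left_mem_Icc.2 zero_le_one⟩ : Icc (0 : ℝ) 1) : ℝ) = z₀ := by
      rw [ODE.FunSpace.compProj_val, ← hα, ODE.FunSpace.next_apply₀]
    exact this
  · apply ODE.hasDerivWithinAt_picard_Icc (f := fun _ z ↦ A z x) (left_mem_Icc.2 zero_le_one)
      hP.continuousOn_uncurry
      α.continuous_compProj.continuousOn (fun _ ht' ↦ α.compProj_mem_closedBall hP.mul_max_le)
      z₀ ht |>.congr_of_mem _ ht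
    intro t' ht'
    nth_rw 1 [← hα]
    rw [ODE.FunSpace.compProj_of_mem ht', ODE.FunSpace.next_apply]

/-- **Frobenius theorem**, for the total differential equation `Df(x) = A(f(x))`. -/
theorem exists_hasFDerivAt_eq_of_symm [CompleteSpace F] {A : F → E →L[ℝ] F} {U : Set F}
    (hU : IsOpen U) (hA : ContDiffOn ℝ ∞ A U)
    (hsymm : ∀ z ∈ U, ∀ v w, fderiv ℝ A z (A z v) w = fderiv ℝ A z (A z w) v)
    {z₀ : F} (hz₀ : z₀ ∈ U) :
    ∃ r > 0, ∃ f : E → F, f 0 = z₀ ∧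
      ∀ x ∈ ball (0 : E) r, f x ∈ U ∧ HasFDerivAt f (A (f x)) x := by
  have hU' : U ∈ 𝓝 z₀ := hU.mem_nhds hz₀
  have hA0 : ContDiffAt ℝ ∞ A z₀ := hA.contDiffAt hU'
  have hdA : ContDiffOn ℝ ∞ (fderiv ℝ A) U := ((contDiffOn_infty_iff_fderiv_of_isOpen hU).1 hA).2
  have hdA0 : ContDiffAt ℝ ∞ (fderiv ℝ A) z₀ := hdA.contDiffAt hU'
  obtain ⟨K, s, hs, hK⟩ := (hA0.of_le (m := 1) (by exact_mod_cast le_top)).exists_lipschitzOnWith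
  obtain ⟨K', s', hs', hK'⟩ := (hdA0.of_le (m := 1) (by exact_mod_cast le_top)).exists_lipschitzOnWith
  have n1 : ∀ᶠ z in 𝓝 z₀, ‖A z‖ < ‖A z₀‖ + 1 :=
    hA0.continuousAt.norm.eventually_lt continuousAt_const (lt_add_one _)
  have n2 : ∀ᶠ z in 𝓝 z₀, ‖fderiv ℝ A z‖ < ‖fderiv ℝ A z₀‖ + 1 := by
    have hc : ContinuousAt (fderiv ℝ A) z₀ := hdA0.continuousAt
    exact (ContinuousAt.norm (E := F →L[ℝ] E →L[ℝ] F) hc).eventually_lt continuousAt_const (lt_add_one _)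
  obtain ⟨a, ha, hB⟩ := nhds_basis_closedBall.eventually_iff.1
    ((((Filter.eventually_mem_set.2 hs).and (Filter.eventually_mem_set.2 hs')).and
      (n1.and n2)).and (Filter.eventually_mem_set.2 hU'))
  set L : ℝ≥0 := ‖A z₀‖₊ + 1
  set N : ℝ≥0 := ‖fderiv ℝ A z₀‖₊ + 1
  have hd : ∀ z ∈ closedBall z₀ a, DifferentiableAt ℝ A z := fun z hz ↦
    (hA.contDiffAt (hU.mem_nhds (hB hz).2)).differentiableAt (by simp)
  have hL : ∀ z ∈ closedBall z₀ a, ‖A z‖ ≤ L := fun z hz ↦ (hB hz).1.2.1.le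
  have hN : ∀ z ∈ closedBall z₀ a, ‖fderiv ℝ A z‖ ≤ N := fun z hz ↦ (hB hz).1.2.2.le
  replace hK := hK.mono fun z hz ↦ (hB hz).1.1.1
  replace hK' := hK'.mono fun z hz ↦ (hB hz).1.1.2
  have hLpos : (0 : ℝ) < L := by positivity
  -- The factor `2` leaves room in the ball of radius `a` both for the solution and for the
  -- correction `t • A (u t) h`.
  set r : ℝ := a / (2 * L)
  have hr : 0 < r := by positivity
  have hrL : L * r ≤ a / 2 := le_of_eq (by simp only [r]; field_simp)
  have hex : ∀ x : E, ∃ u : ℝ → F, ‖x‖ < r → u 0 = z₀ ∧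
      (∀ t ∈ Icc (0 : ℝ) 1, HasDerivWithinAt u (A (u t) x) (Icc 0 1) t) ∧
      ∀ t ∈ Icc (0 : ℝ) 1, u t ∈ closedBall z₀ (L * ‖x‖) := fun x ↦ by
    by_cases hx : ‖x‖ < r
    · obtain ⟨u, hu⟩ := exists_radial_solution hL hK (x := x)
        ((mul_le_mul_of_nonneg_left hx.le L.2).trans (hrL.trans (half_le_self ha.le)))
      exact ⟨u, fun _ ↦ hu⟩
    · exact ⟨0, fun h ↦ absurd h hx⟩
  choose u hu using hex
  have h1 : (1 : ℝ) ∈ Icc (0 : ℝ) 1 := right_mem_Icc.2 zero_le_one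
  refine ⟨r, hr, fun x ↦ u x 1, ?_, fun x hx ↦ ?_⟩
  -- For `x = 0` the confining ball has radius `0`.
  · have := (hu 0 (by simpa using hr)).2.2 1 h1
    simpa using this
  · have hx' : ‖x‖ < r := by simpa using hx
    refine ⟨(hB (closedBall_subset_closedBall ?_ ((hu x hx').2.2 1 h1))).2, ?_⟩
    · exact (mul_le_mul_of_nonneg_left hx'.le L.2).trans (hrL.trans (half_le_self ha.le))
    rw [hasFDerivAt_iff_isLittleO_nhds_zero]
    refine Asymptotics.IsBigO.trans_isLittleO (g := fun h : E ↦ ‖h‖ ^ 2) ?_ ?_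
    · refine Asymptotics.IsBigO.of_bound
        ((K' * L ^ 2 * r + N * L) * (Real.exp (K * r + 1) / (K * r + 1))) ?_
      have e1 : ∀ᶠ h : E in 𝓝 0, ‖x + h‖ < r :=
        (by fun_prop : ContinuousAt (fun h : E ↦ ‖x + h‖) 0).eventually_lt continuousAt_const
          (by simpa using hx')
      have e2 : ∀ᶠ h : E in 𝓝 0, ‖h‖ < r :=
        continuousAt_id.norm.eventually_lt continuousAt_const (by simpa using hr)
      filter_upwards [e1, e2] with h hxh hh
      rw [norm_pow, norm_norm]
      exact norm_radial_solution_sub_le hd hL hK hN hK'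
        (fun z hz ↦ hsymm z (hB hz).2) hr hrL hx' hxh hh (hu x hx').1 (hu _ hxh).1
        (hu x hx').2.1 (hu _ hxh).2.1 (hu x hx').2.2 (hu _ hxh).2.2
    · simpa using Asymptotics.isLittleO_norm_pow_id (E' := E) one_lt_two

/-- A solution of `Df = A ∘ f` with `A` smooth is smooth. -/
lemma contDiffOn_of_hasFDerivAt_eq {A : F → E →L[ℝ] F} {U : Set F}
    (hA : ContDiffOn ℝ ∞ A U) {f : E → F} {s : Set E} (hs : IsOpen s)
    (hf : ∀ x ∈ s, f x ∈ U ∧ HasFDerivAt f (A (f x)) x) : ContDiffOn ℝ ∞ f s := by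
  rw [contDiffOn_infty]
  intro n
  -- Bootstrap: if `f` is `C^n`, so is `Df = A ∘ f`, and `f` is `C^(n+1)`.
  induction n with
  | zero =>
    exact contDiffOn_zero.2 fun x hx ↦ (hf x hx).2.continuousAt.continuousWithinAt
  | succ n ih =>
    have := (contDiffOn_succ_iff_fderiv_of_isOpen (𝕜 := ℝ) (f := f) (n := n) hs).2
      ⟨fun x hx ↦ (hf x hx).2.differentiableAt.differentiableWithinAt, by simp,
        ((hA.of_le (m := n) (by exact_mod_cast le_top)).comp ih fun x hx ↦ (hf x hx).1).congr
          fun x hx ↦ (hf x hx).2.fderiv⟩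
    exact_mod_cast this

end Frobenius

/-! ### Frobenius theorem for distributions in a vector space. -/

section FrobeniusFrame

open Set Metric

variable {E F G : Type*} [NormedAddCommGroup E] [NormedSpace ℝ E] [FiniteDimensional ℝ E]
  [NormedAddCommGroup F] [NormedSpace ℝ F] [FiniteDimensional ℝ F]
  [NormedAddCommGroup G] [NormedSpace ℝ G]

/-- **Frobenius theorem** for an involutive distribution `z ↦ W z (V₀)` given by a smooth family
`W` of injective linear maps: there is an integral manifold through each point, which is the image
of a section `f` of a linear projection `P`. -/
theorem exists_integral_section {U : Set F} (hU : IsOpen U) {W : F → G →L[ℝ] F}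
    (hW : ContDiffOn ℝ ∞ W U) (hinj : ∀ z ∈ U, Function.Injective (W z)) {V₀ : Submodule ℝ G}
    (i : E ≃L[ℝ] V₀)
    (hinv : ∀ z ∈ U, ∀ a ∈ V₀, ∀ b ∈ V₀,
      fderiv ℝ W z (W z a) b - fderiv ℝ W z (W z b) a ∈ V₀.map (W z).toLinearMap)
    {z₀ : F} (hz₀ : z₀ ∈ U) :
    ∃ r > 0, ∃ (f : E → F) (P : F →L[ℝ] E) (j : E →L[ℝ] F),
      (∀ x, P (j x) = x) ∧ f 0 = z₀ ∧ (∀ x ∈ ball (0 : E) r, f x ∈ U) ∧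
      ContDiffOn ℝ ∞ f (ball 0 r) ∧ (∀ x ∈ ball (0 : E) r, P (f x) = P z₀ + x) ∧
      ∀ x ∈ ball (0 : E) r,
        LinearMap.range (fderiv ℝ f x).toLinearMap = V₀.map (W (f x)).toLinearMap := by
  have : CompleteSpace E := FiniteDimensional.complete ℝ E
  have : CompleteSpace F := FiniteDimensional.complete ℝ F
  set ι : E →L[ℝ] G := V₀.subtypeL.comp (i : E →L[ℝ] V₀) with hι
  have hιinj : Function.Injective ι := V₀.injective_subtype.comp i.injective
  have hιmem : ∀ x, ι x ∈ V₀ := fun x ↦ (i x).2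
  have hιrange : ∀ a ∈ V₀, ∃ x, ι x = a := fun a ha ↦ ⟨i.symm ⟨a, ha⟩, by simp [hι]⟩
  set j : E →L[ℝ] F := (W z₀).comp ι with hj
  have hjinj : Function.Injective j := (hinj z₀ hz₀).comp hιinj
  obtain ⟨P', hP'⟩ := j.toLinearMap.exists_leftInverse_of_injective (LinearMap.ker_eq_bot.2 hjinj)
  set P : F →L[ℝ] E := LinearMap.toContinuousLinearMap P'
  have hPj : ∀ x, P (j x) = x := fun x ↦ LinearMap.congr_fun hP' x
  -- `Q z₀ = 1`, so `Q` is invertible near `z₀`. Dividing by it gives the basis `A z` of `W z (V₀)`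
  -- with `P ∘ A z = id`.
  set Q : F → E →L[ℝ] E := fun z ↦ P.comp ((W z).comp ι) with hQ
  have hQs : ContDiffOn ℝ ∞ Q U := contDiffOn_const.clm_comp (hW.clm_comp contDiffOn_const)
  have hQ0 : Q z₀ = 1 := ContinuousLinearMap.ext hPj
  set U' : Set F := U ∩ Q ⁻¹' {T | IsUnit T} with hU'
  have hU'o : IsOpen U' := hQs.continuousOn.isOpen_inter_preimage hU Units.isOpen
  have hz₀' : z₀ ∈ U' := ⟨hz₀, by simp [hQ0]⟩
  set C : F → E →L[ℝ] G := fun z ↦ ι.comp (Ring.inverse (Q z)) with hC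
  have hDs : ContDiffOn ℝ ∞ (fun z ↦ Ring.inverse (Q z)) U' := fun z hz ↦ by
    obtain ⟨T, hT⟩ := hz.2
    have h1 : ContDiffAt ℝ ∞ Ring.inverse (Q z) := hT ▸ contDiffAt_ringInverse ℝ T
    exact h1.comp_contDiffWithinAt z ((hQs z hz.1).mono inter_subset_left)
  have hCs : ContDiffOn ℝ ∞ C U' := contDiffOn_const.clm_comp hDs
  set A : F → E →L[ℝ] F := fun z ↦ (W z).comp (C z) with hA
  have hWs : ContDiffOn ℝ ∞ W U' := hW.mono inter_subset_left
  have hAs : ContDiffOn ℝ ∞ A U' := hWs.clm_comp hCs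
  have hPA : ∀ z ∈ U', ∀ x, P (A z x) = x := fun z hz x ↦ by
    have := Ring.mul_inverse_cancel _ hz.2
    exact DFunLike.congr_fun this x
  have hCmem : ∀ z x, C z x ∈ V₀ := fun z x ↦ hιmem _
  have hCrange : ∀ z ∈ U', ∀ a ∈ V₀, ∃ x, C z x = a := fun z hz a ha ↦ by
    obtain ⟨x, rfl⟩ := hιrange a ha
    refine ⟨Q z x, ?_⟩
    have := Ring.inverse_mul_cancel _ hz.2
    exact congrArg ι (DFunLike.congr_fun this x)
  have hdiff : ∀ z ∈ U', HasFDerivAt W (fderiv ℝ W z) z ∧ HasFDerivAt C (fderiv ℝ C z) z :=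
    fun z hz ↦ ⟨((hWs.contDiffAt (hU'o.mem_nhds hz)).differentiableAt (by simp)).hasFDerivAt,
      ((hCs.contDiffAt (hU'o.mem_nhds hz)).differentiableAt (by simp)).hasFDerivAt⟩
  have hdC : ∀ z ∈ U', ∀ k w, fderiv ℝ C z k w ∈ V₀ := fun z hz k w ↦ by
    have h1 : HasFDerivAt (fun z ↦ Ring.inverse (Q z)) _ z :=
      ((hDs.contDiffAt (hU'o.mem_nhds hz)).differentiableAt (by simp)).hasFDerivAt
    have h2 := ((hasFDerivAt_const ι z).clm_comp h1).fderiv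
    rw [hC, h2]
    simp [hιmem]
  have hdA : ∀ z ∈ U', ∀ k w,
      fderiv ℝ A z k w = fderiv ℝ W z k (C z w) + W z (fderiv ℝ C z k w) := fun z hz k w ↦ by
    have := ((hdiff z hz).1.clm_comp (hdiff z hz).2).fderiv
    rw [hA, this]
    simp [add_comm]
  -- This is the derivative of the constant `P (A z w) = w`.
  have hPdA : ∀ z ∈ U', ∀ k w, P (fderiv ℝ A z k w) = 0 := fun z hz k w ↦ by
    have hAd : HasFDerivAt A (fderiv ℝ A z) z :=
      ((hAs.contDiffAt (hU'o.mem_nhds hz)).differentiableAt (by simp)).hasFDerivAt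
    have h1 : HasFDerivAt (fun z ↦ P (A z w))
        (P.comp ((ContinuousLinearMap.apply ℝ F w).comp (fderiv ℝ A z))) z :=
      P.hasFDerivAt.comp z ((ContinuousLinearMap.apply ℝ F w).hasFDerivAt.comp z hAd)
    have h2 : HasFDerivAt (fun z ↦ P (A z w)) (0 : F →L[ℝ] E) z :=
      (hasFDerivAt_const w z).congr_of_eventuallyEq
        (Filter.eventuallyEq_of_mem (hU'o.mem_nhds hz) fun y hy ↦ hPA y hy w)
    exact DFunLike.congr_fun (h1.unique h2) k
  -- The difference of the two sides lies in `W z (V₀)` by involutivity, the derivatives of `C`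
  -- contributing only vectors of `W z (V₀)`. It is also killed by `P`, which is injective there.
  have hsymm : ∀ z ∈ U', ∀ v w, fderiv ℝ A z (A z v) w = fderiv ℝ A z (A z w) v := by
    intro z hz v w
    have hmem : fderiv ℝ A z (A z v) w - fderiv ℝ A z (A z w) v ∈ V₀.map (W z).toLinearMap := by
      have h1 := hinv z hz.1 (C z v) (hCmem z v) (C z w) (hCmem z w)
      have h2 : W z (fderiv ℝ C z (A z v) w - fderiv ℝ C z (A z w) v) ∈
          V₀.map (W z).toLinearMap :=
        Submodule.mem_map_of_mem (V₀.sub_mem (hdC z hz _ _) (hdC z hz _ _))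
      have := Submodule.add_mem _ h1 h2
      rw [map_sub] at this
      rw [hdA z hz, hdA z hz]
      convert this using 1
      simp only [hA, ContinuousLinearMap.comp_apply]
      abel
    obtain ⟨a, ha, hae⟩ := hmem
    obtain ⟨x, rfl⟩ := hCrange z hz a ha
    have h0 : P (A z x) = 0 := by
      have : A z x = fderiv ℝ A z (A z v) w - fderiv ℝ A z (A z w) v := hae
      rw [this, map_sub, hPdA z hz, hPdA z hz, sub_zero]
    rw [hPA z hz] at h0
    rw [h0] at hae
    exact sub_eq_zero.1 (hae.symm.trans (A z).map_zero)
  obtain ⟨r, hr, f, hf0, hf⟩ := exists_hasFDerivAt_eq_of_symm hU'o hAs hsymm hz₀'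
  refine ⟨r, hr, f, P, j, hPj, hf0, fun x hx ↦ (hf x hx).1.1,
    contDiffOn_of_hasFDerivAt_eq hAs isOpen_ball hf, ?_, fun x hx ↦ ?_⟩
  · have hd : ∀ x ∈ ball (0 : E) r, HasFDerivAt (fun x ↦ P (f x)) (ContinuousLinearMap.id ℝ E) x :=
      fun x hx ↦ (P.hasFDerivAt.comp x (hf x hx).2).congr_fderiv
        (ContinuousLinearMap.ext (hPA _ (hf x hx).1))
    have hd' : ∀ x : E, HasFDerivAt (fun x ↦ P z₀ + x) (ContinuousLinearMap.id ℝ E) x :=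
      fun x ↦ (hasFDerivAt_id x).const_add _
    exact isOpen_ball.eqOn_of_fderiv_eq (convex_ball (0 : E) r).isPreconnected
      (fun x hx ↦ (hd x hx).differentiableAt.differentiableWithinAt)
      (fun x _ ↦ (hd' x).differentiableAt.differentiableWithinAt)
      (fun x hx ↦ (hd x hx).fderiv.trans (hd' x).fderiv.symm) (mem_ball_self hr) (by simp [hf0])
  · rw [(hf x hx).2.fderiv]
    ext y
    constructor
    · rintro ⟨v, rfl⟩
      exact Submodule.mem_map_of_mem (hCmem _ v)
    · rintro ⟨a, ha, rfl⟩
      obtain ⟨v, rfl⟩ := hCrange _ (hf x hx).1 a ha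
      exact ⟨v, rfl⟩

end FrobeniusFrame

/-! ### Flattening the image of a section. -/

section Straighten

open Set Metric

variable {E F : Type*} [NormedAddCommGroup E] [NormedSpace ℝ E]
  [NormedAddCommGroup F] [NormedSpace ℝ F]

/-- The diffeomorphism which straightens the image of a section `f` of the linear map `P`, where
`j` is a linear section. -/
def straighten (P : F →L[ℝ] E) (j : E →L[ℝ] F) (hPj : ∀ x, P (j x) = x) (f : E → F) (z₀ : F) {r : ℝ}
    (hf : ContinuousOn f (ball 0 r)) (hPf : ∀ x ∈ ball (0 : E) r, P (f x) = P z₀ + x) :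
    OpenPartialHomeomorph F F where
  -- The second summand is in the kernel of `P`, so `P` of the value is `P (z - z₀)`, from which `z`
  -- is recovered. The point `f x` goes to `j x`.
  toFun z := j (P (z - z₀)) + (z - f (P (z - z₀)))
  invFun w := w - j (P w) + f (P w)
  source := {z | P (z - z₀) ∈ ball 0 r}
  target := {w | P w ∈ ball 0 r}
  map_source' z hz := by
    have : P (j (P (z - z₀)) + (z - f (P (z - z₀)))) = P (z - z₀) := by
      rw [map_add, hPj, map_sub P z (f _), hPf _ hz, map_sub]
      abel
    rwa [mem_ofPred_eq, this]
  map_target' w hw := by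
    have : P (w - j (P w) + f (P w) - z₀) = P w := by
      rw [map_sub, map_add, map_sub, hPj, hPf _ hw]
      abel
    rwa [mem_ofPred_eq, this]
  left_inv' z hz := by
    have : P (j (P (z - z₀)) + (z - f (P (z - z₀)))) = P (z - z₀) := by
      rw [map_add, hPj, map_sub P z (f _), hPf _ hz, map_sub]
      abel
    rw [this]
    abel
  right_inv' w hw := by
    have : P (w - j (P w) + f (P w) - z₀) = P w := by
      rw [map_sub, map_add, map_sub, hPj, hPf _ hw]
      abel
    rw [this]
    abel
  open_source := isOpen_ball.preimage (by fun_prop)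
  open_target := isOpen_ball.preimage (by fun_prop)
  continuousOn_toFun := by
    have : ContinuousOn (fun z ↦ f (P (z - z₀))) {z | P (z - z₀) ∈ ball 0 r} :=
      hf.comp (Continuous.continuousOn (by fun_prop)) fun _ hz ↦ hz
    exact (Continuous.continuousOn (by fun_prop)).add (continuousOn_id.sub this)
  continuousOn_invFun := by
    have : ContinuousOn (fun z ↦ f (P z)) {z | P z ∈ ball 0 r} :=
      hf.comp (Continuous.continuousOn (by fun_prop)) fun _ hz ↦ hz
    exact (Continuous.continuousOn (by fun_prop)).add this

lemma contDiffOn_straighten {P : F →L[ℝ] E} {j : E →L[ℝ] F} (hPj : ∀ x, P (j x) = x) {f : E → F}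
    {z₀ : F} {r : ℝ} (hf : ContDiffOn ℝ ∞ f (ball 0 r))
    (hPf : ∀ x ∈ ball (0 : E) r, P (f x) = P z₀ + x) :
    ContDiffOn ℝ ∞ (straighten P j hPj f z₀ hf.continuousOn hPf) {z | P (z - z₀) ∈ ball 0 r} := by
  have h1 : ContDiffOn ℝ ∞ (fun z ↦ P (z - z₀)) {z | P (z - z₀) ∈ ball 0 r} :=
    ContDiff.contDiffOn (by fun_prop)
  have h2 : ContDiffOn ℝ ∞ (fun z ↦ f (P (z - z₀))) {z | P (z - z₀) ∈ ball 0 r} :=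
    hf.comp h1 fun _ hz ↦ hz
  exact (j.contDiff.comp_contDiffOn h1).add (contDiffOn_id.sub h2)

lemma contDiffOn_straighten_symm {P : F →L[ℝ] E} {j : E →L[ℝ] F} (hPj : ∀ x, P (j x) = x)
    {f : E → F} {z₀ : F} {r : ℝ} (hf : ContDiffOn ℝ ∞ f (ball 0 r))
    (hPf : ∀ x ∈ ball (0 : E) r, P (f x) = P z₀ + x) :
    ContDiffOn ℝ ∞ (straighten P j hPj f z₀ hf.continuousOn hPf).symm {w | P w ∈ ball 0 r} := by
  have h2 : ContDiffOn ℝ ∞ (fun w ↦ f (P w)) {w | P w ∈ ball 0 r} :=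
    hf.comp P.contDiff.contDiffOn fun _ hz ↦ hz
  have h3 : ContDiff ℝ ∞ fun w ↦ w - j (P w) := by fun_prop
  exact h3.contDiffOn.add h2

end Straighten

/-! ### Product rule on manifolds. -/

section ClmApply

variable {n : ℕ} {M : Type*} [TopologicalSpace M] [ChartedSpace (EuclideanSpace ℝ (Fin n)) M]
  {E F : Type*} [NormedAddCommGroup E] [NormedSpace ℝ E] [NormedAddCommGroup F] [NormedSpace ℝ F]

/-- The product rule for the application of a linear map to a vector. -/
lemma mvfderiv_clm_apply {W : M → E →L[ℝ] F} {c : M → E} {q : M}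
    (hW : MDifferentiableAt (𝓡 n) 𝓘(ℝ, E →L[ℝ] F) W q)
    (hc : MDifferentiableAt (𝓡 n) 𝓘(ℝ, E) c q) (x : TangentSpace (𝓡 n) q) :
    mvfderiv (𝓡 n) (fun q' ↦ W q' (c q')) q x =
      W q (mvfderiv (𝓡 n) c q x) + mvfderiv (𝓡 n) W q x (c q) := by
  have h : HasMFDerivAt (𝓡 n) 𝓘(ℝ, F) (fun q' ↦ W q' (c q')) q _ :=
    ⟨(isBoundedBilinearMap_apply (𝕜 := ℝ).continuous.tendsto _).comp
      (hW.continuousAt.prodMk_nhds hc.continuousAt), hW.hasMFDerivAt.2.clm_apply hc.hasMFDerivAt.2⟩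
  have e1 : writtenInExtChartAt (𝓡 n) 𝓘(ℝ, E →L[ℝ] F) q W (extChartAt (𝓡 n) q q) = W q := by
    simp only [writtenInExtChartAt, Function.comp_apply, extChartAt_to_inv]
    rfl
  have e2 : c ((extChartAt (𝓡 n) q).symm (extChartAt (𝓡 n) q q)) = c q := by
    rw [extChartAt_to_inv]
  exact (DFunLike.congr_fun h.mfderiv x).trans <| congrArg₂ (· + ·)
    (DFunLike.congr_fun e1 (mvfderiv (𝓡 n) c q x)) (congrArg (mvfderiv (𝓡 n) W q x) e2)

/-- A function and a locally equal function have the same differential. -/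
lemma mvfderiv_eq_of_eventuallyEq {f g : M → E} {q : M} (h : f =ᶠ[𝓝 q] g)
    (x : TangentSpace (𝓡 n) q) : mvfderiv (𝓡 n) f q x = mvfderiv (𝓡 n) g q x := by
  have := h.mfderiv_eq (I := 𝓡 n) (I' := 𝓘(ℝ, E))
  exact DFunLike.congr_fun this x

end ClmApply

/-! ### Parallel frames and derivatives of fields in a parallel distribution. -/

section Frame

variable {m : ℕ} {S : Type*} [TopologicalSpace S] [ChartedSpace (EuclideanSpace ℝ (Fin m)) S]
  [IsManifold (𝓡 m) ∞ S]

lemma mdifferentiableAt_of_mem_smoothVF {Z : Π p : S, TangentSpace (𝓡 m) p}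
    (hZ : Z ∈ smoothVF m S) (p : S) :
    MDifferentiableAt (𝓡 m) (𝓡 m).tangent (fun p ↦ (⟨p, Z p⟩ : TangentBundle (𝓡 m) S)) p :=
  (hZ p).mdifferentiableAt (by simp)

/-- The vector space of parallel vector fields. -/
def parallelSubmodule (cov : AffineConnection m S) :
    Submodule ℝ (Π p : S, TangentSpace (𝓡 m) p) where
  carrier := parallelVF cov
  add_mem' {X Y} hX hY := by
    refine ⟨ContMDiff.add_section hX.1 hY.1, fun Z hZ p ↦ ?_⟩
    rw [cov.isCovariantDerivativeOnUniv.add (mdifferentiableAt_of_mem_smoothVF hX.1 p)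
      (mdifferentiableAt_of_mem_smoothVF hY.1 p)]
    simp [hX.2 Z hZ p, hY.2 Z hZ p]
  zero_mem' := by
    refine ⟨Bundle.contMDiff_zeroSection ℝ _, fun Z hZ p ↦ ?_⟩
    rw [cov.zero]
    simp
  smul_mem' a X hX := by
    refine ⟨ContMDiff.const_smul_section hX.1, fun Z hZ p ↦ ?_⟩
    rw [cov.isCovariantDerivativeOnUniv.smul_const a (mdifferentiableAt_of_mem_smoothVF hX.1 p)]
    simp [hX.2 Z hZ p]

variable (X : Fin m → Π p : S, TangentSpace (𝓡 m) p)

/-- The linear combinations of the vectors of a frame. -/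
def frameMap (p : S) : EuclideanSpace ℝ (Fin m) →L[ℝ] TangentSpace (𝓡 m) p :=
  ∑ i, (EuclideanSpace.proj i : EuclideanSpace ℝ (Fin m) →L[ℝ] ℝ).smulRight (X i p)

lemma frameMap_apply (p : S) (c : EuclideanSpace ℝ (Fin m)) :
    frameMap X p c = ∑ i, c i • X i p := by
  simp [frameMap]

variable {X}

lemma frameMap_injective {p : S} (h : LinearIndependent ℝ fun i ↦ X i p) :
    Function.Injective (frameMap X p) := by
  rw [injective_iff_map_eq_zero]
  intro c hc
  rw [frameMap_apply] at hc
  ext i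
  exact Fintype.linearIndependent_iff.1 h _ hc i

lemma frameMap_surjective {p : S} (h : LinearIndependent ℝ fun i ↦ X i p) :
    Function.Surjective (frameMap X p) :=
  LinearMap.surjective_of_injective (f := (frameMap X p).toLinearMap)
    (V := EuclideanSpace ℝ (Fin m)) (frameMap_injective h)

variable {cov : AffineConnection m S}

lemma frameMap_mem_parallelVF (hX : ∀ i, X i ∈ parallelVF cov) (c : EuclideanSpace ℝ (Fin m)) :
    (fun p ↦ frameMap X p c) ∈ parallelVF cov := by
  have : ∑ i, c i • X i ∈ parallelSubmodule cov :=
    Submodule.sum_mem _ fun i _ ↦ Submodule.smul_mem _ _ (hX i)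
  have e : (fun p ↦ frameMap X p c) = ∑ i, c i • X i := by
    ext1 p
    rw [frameMap_apply]
    simp
  rw [e]
  exact this

/-- Parallelism is tested on global smooth fields; the frame extends every tangent vector to such a
field. -/
lemma cov_eq_zero_of_parallel (hX : ∀ i, X i ∈ parallelVF cov)
    (hli : ∀ p, LinearIndependent ℝ fun i ↦ X i p) {Z : Π p : S, TangentSpace (𝓡 m) p}
    (hZ : Z ∈ parallelVF cov) (p : S) (u : TangentSpace (𝓡 m) p) : cov Z p u = 0 := by
  obtain ⟨c, rfl⟩ := frameMap_surjective (hli p) u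
  exact hZ.2 _ (frameMap_mem_parallelVF hX c).1 p

variable {V : Π p : S, Submodule ℝ (TangentSpace (𝓡 m) p)}

lemma frameMap_mem (hX : ∀ i, X i ∈ parallelVF cov) (hV : IsParallelDistribution cov V)
    {p : S} (q : S) {c : EuclideanSpace ℝ (Fin m)} (hc : frameMap X p c ∈ V p) :
    frameMap X q c ∈ V q := by
  have := hV p q
  exact this.subset ⟨_, hc, _, frameMap_mem_parallelVF hX c, rfl, rfl⟩

/-- In a parallel frame, a parallel distribution is constant. -/
lemma exists_eq_map_frameMap [Nonempty S] (hX : ∀ i, X i ∈ parallelVF cov)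
    (hli : ∀ p, LinearIndependent ℝ fun i ↦ X i p) (hV : IsParallelDistribution cov V) :
    ∃ V₀ : Submodule ℝ (EuclideanSpace ℝ (Fin m)), ∀ p, V p = V₀.map (frameMap X p).toLinearMap := by
  obtain ⟨p₀⟩ := ‹Nonempty S›
  refine ⟨(V p₀).comap (frameMap X p₀).toLinearMap, fun p ↦ ?_⟩
  ext v
  constructor
  · intro hv
    obtain ⟨c, rfl⟩ := frameMap_surjective (hli p) v
    exact ⟨c, frameMap_mem hX hV p₀ hv, rfl⟩
  · rintro ⟨c, hc, rfl⟩
    exact frameMap_mem hX hV p hc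

variable {n : ℕ} {M : Type*} [TopologicalSpace M] [ChartedSpace (EuclideanSpace ℝ (Fin n)) M]

lemma covAlong_eq {f : M → S} {Y : Π q : M, TangentSpace (𝓡 m) (f q)} {q : M}
    {x : TangentSpace (𝓡 n) q} {v : EuclideanSpace ℝ (Fin m)}
    (hv : mvfderiv (𝓡 n) (fun q' ↦ ((tangentTriv (f q)) ⟨f q', Y q'⟩).2) q x = v) :
    covAlong cov f Y q x = (tangentTriv (f q)).symmL ℝ (f q) v +
      cov (FiberBundle.extend (EuclideanSpace ℝ (Fin m)) (Y q)) (f q)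
        (mfderiv (𝓡 n) (𝓡 m) f q x) := by
  subst hv
  rfl

/-- The derivative, with respect to the induced connection, of a field with values in a parallel
distribution has values in this distribution. -/
theorem covAlong_mem (hX : ∀ i, X i ∈ parallelVF cov)
    (hli : ∀ p, LinearIndependent ℝ fun i ↦ X i p)
    {V₀ : Submodule ℝ (EuclideanSpace ℝ (Fin m))}
    (hV₀ : ∀ p, V p = V₀.map (frameMap X p).toLinearMap) {f : M → S}
    {Y : Π q : M, TangentSpace (𝓡 m) (f q)} {q : M}
    (hf : MDifferentiableAt (𝓡 n) (𝓡 m) f q)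
    (hY : MDifferentiableAt (𝓡 n) (𝓡 m).tangent
      (fun q' ↦ (⟨f q', Y q'⟩ : TangentBundle (𝓡 m) S)) q)
    (hmem : ∀ q', Y q' ∈ V (f q')) (x : TangentSpace (𝓡 n) q) :
    covAlong cov f Y q x ∈ V (f q) := by
  set p := f q with hp
  set τ := tangentTriv (m := m) p with hτ
  have hpτ : p ∈ τ.baseSet := FiberBundle.mem_baseSet_trivializationAt' p
  -- The matrix of the parallel frame in the trivialization at `p`.
  set W : S → EuclideanSpace ℝ (Fin m) →L[ℝ] EuclideanSpace ℝ (Fin m) :=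
    fun p' ↦ ∑ i, (EuclideanSpace.proj i : EuclideanSpace ℝ (Fin m) →L[ℝ] ℝ).smulRight
      (τ ⟨p', X i p'⟩).2 with hW
  have hτL : ∀ p' ∈ τ.baseSet, ∀ v : TangentSpace (𝓡 m) p',
      (τ ⟨p', v⟩).2 = τ.continuousLinearMapAt ℝ p' v := fun p' hp' v ↦ by
    rw [Bundle.Trivialization.continuousLinearMapAt_apply, τ.coe_linearMapAt_of_mem hp']
  have hWapp : ∀ p' ∈ τ.baseSet, ∀ c, W p' c = (τ ⟨p', frameMap X p' c⟩).2 := fun p' hp' c ↦ by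
    rw [hτL p' hp', frameMap_apply, map_sum]
    simp [hW, hτL p' hp']
  have hWd : MDifferentiableAt (𝓡 m) 𝓘(ℝ, EuclideanSpace ℝ (Fin m) →L[ℝ] EuclideanSpace ℝ (Fin m))
      W p := by
    have hsum : ∀ i, MDifferentiableAt (𝓡 m)
        𝓘(ℝ, EuclideanSpace ℝ (Fin m) →L[ℝ] EuclideanSpace ℝ (Fin m))
        (fun p' ↦ (EuclideanSpace.proj i : EuclideanSpace ℝ (Fin m) →L[ℝ] ℝ).smulRight
          (τ ⟨p', X i p'⟩).2) p := fun i ↦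
      (ContinuousLinearMap.smulRightL ℝ (EuclideanSpace ℝ (Fin m)) (EuclideanSpace ℝ (Fin m))
        (EuclideanSpace.proj i)).differentiableAt.comp_mdifferentiableAt
        (coord_diff (X i) p (mdifferentiableAt_of_mem_smoothVF (hX i).1 p))
    have e : W = ∑ i, fun p' ↦ (EuclideanSpace.proj i :
        EuclideanSpace ℝ (Fin m) →L[ℝ] ℝ).smulRight (τ ⟨p', X i p'⟩).2 := by
      ext1 p'
      simp [hW]
    rw [e]
    exact MDifferentiableAt.sum fun i _ ↦ hsum i
  have hWf := hWd.comp q hf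
  set y : M → EuclideanSpace ℝ (Fin m) := fun q' ↦ (τ ⟨f q', Y q'⟩).2 with hy
  have hyd : MDifferentiableAt (𝓡 n) 𝓘(ℝ, EuclideanSpace ℝ (Fin m)) y q :=
    ((mdifferentiableAt_totalSpace _ _).1 hY).2
  have hWinj : ∀ p' ∈ τ.baseSet, Function.Injective (W p') := fun p' hp' c c' h ↦ by
    rw [hWapp p' hp', hWapp p' hp', hτL p' hp', hτL p' hp'] at h
    have := congrArg (τ.symmL ℝ p') h
    rw [τ.symmL_continuousLinearMapAt hp', τ.symmL_continuousLinearMapAt hp'] at this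
    exact frameMap_injective (hli p') this
  have hWunit : ∀ p' ∈ τ.baseSet, IsUnit (W p') := fun p' hp' ↦
    ContinuousLinearMap.isUnit_iff_bijective.2 ⟨hWinj p' hp',
      LinearMap.surjective_of_injective (f := (W p').toLinearMap) (hWinj p' hp')⟩
  set c₁ : M → EuclideanSpace ℝ (Fin m) := fun q' ↦ Ring.inverse (W (f q')) (y q') with hc₁
  have hc₁d : MDifferentiableAt (𝓡 n) 𝓘(ℝ, EuclideanSpace ℝ (Fin m)) c₁ q := by
    obtain ⟨T, hT⟩ := hWunit p hpτ
    have h1 : DifferentiableAt ℝ Ring.inverse (W (f q)) := by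
      rw [← hp, ← hT]
      exact (contDiffAt_ringInverse ℝ (n := 1) T).differentiableAt one_ne_zero
    exact MDifferentiableAt.clm_apply
      (DifferentiableAt.comp_mdifferentiableAt (g := Ring.inverse) h1 hWf) hyd
  -- Near `q` the coefficients `c₁` already lie in `V₀` and the projection changes nothing. It makes
  -- `dc(x) ∈ V₀` immediate by linearity.
  set c : M → EuclideanSpace ℝ (Fin m) := fun q' ↦ V₀.starProjection (c₁ q') with hc
  have hcd : MDifferentiableAt (𝓡 n) 𝓘(ℝ, EuclideanSpace ℝ (Fin m)) c q :=
    V₀.starProjection.differentiableAt.comp_mdifferentiableAt hc₁d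
  have hdc : mvfderiv (𝓡 n) c q x ∈ V₀ := by
    have h1 := mvfderiv_clm_apply (W := fun _ ↦ V₀.starProjection)
      mdifferentiableAt_const hc₁d x
    rw [mvfderiv_const] at h1
    rw [hc, h1]
    simp
  have hyW : ∀ q', f q' ∈ τ.baseSet → Y q' = frameMap X (f q') (c q') := fun q' hq' ↦ by
    obtain ⟨a, ha, hae⟩ := (hV₀ (f q')).le (hmem q')
    have hya : y q' = W (f q') a := by
      rw [hWapp _ hq', hy]
      simp only [← hae]
      rfl
    have : c₁ q' = a := by
      rw [hc₁]
      simp only [hya]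
      exact DFunLike.congr_fun (Ring.inverse_mul_cancel _ (hWunit _ hq')) a
    rw [hc]
    simp only [this]
    rw [Submodule.starProjection_eq_self_iff.2 ha]
    exact hae.symm
  have hev : ∀ᶠ q' in 𝓝 q, f q' ∈ τ.baseSet :=
    hf.continuousAt.eventually (τ.open_baseSet.mem_nhds hpτ)
  have e1 : y =ᶠ[𝓝 q] fun q' ↦ W (f q') (c q') := by
    filter_upwards [hev] with q' hq'
    rw [hWapp _ hq', ← hyW q' hq']
  have e2 : (fun q' ↦ (τ ⟨f q', frameMap X (f q') (c q)⟩).2) =ᶠ[𝓝 q] fun q' ↦ W (f q') (c q) := by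
    filter_upwards [hev] with q' hq'
    rw [hWapp _ hq']
  have hZ := frameMap_mem_parallelVF hX (c q)
  -- Freezing the coefficients at `q` gives a restricted parallel field with the same value at `q`
  -- as `Y`. Its derivative vanishes and contains all terms of the derivative of `Y` except the one
  -- with `dc(x)`.
  have h0 : covAlong cov f (fun q' ↦ frameMap X (f q') (c q)) q x = 0 :=
    (covAlong_comp cov f (fun p ↦ frameMap X p (c q)) q hf
      (mdifferentiableAt_of_mem_smoothVF hZ.1 _) x).trans (cov_eq_zero_of_parallel hX hli hZ _ _)
  have key : covAlong cov f Y q x = frameMap X p (mvfderiv (𝓡 n) c q x) := by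
    have d1 : mvfderiv (𝓡 n) y q x = _ :=
      (mvfderiv_eq_of_eventuallyEq e1 x).trans (mvfderiv_clm_apply hWf hcd x)
    have d2 := (mvfderiv_eq_of_eventuallyEq e2 x).trans
      (mvfderiv_clm_apply hWf mdifferentiableAt_const x)
    rw [mvfderiv_const] at d2
    rw [covAlong_eq d2] at h0
    rw [covAlong_eq d1, hyW q hpτ, map_add, add_assoc]
    simp only [zero_apply, map_zero, zero_add] at h0
    rw [h0, add_zero]
    have h3 := hWapp p hpτ (mvfderiv (𝓡 n) c q x)
    rw [hτL p hpτ] at h3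
    exact (congrArg (τ.symmL ℝ p) h3).trans (τ.symmL_continuousLinearMapAt hpτ _)
  rw [key, hV₀]
  exact Submodule.mem_map_of_mem hdc

end Frame

/-! ### Torsion on tangent vectors of a submanifold. -/

section Torsion

open VectorField

variable {m : ℕ} {S : Type*} [TopologicalSpace S] [ChartedSpace (EuclideanSpace ℝ (Fin m)) S]
  [IsManifold (𝓡 m) ∞ S]

lemma tangentTriv_apply {p p' : S} (hp' : p' ∈ (chartAt (EuclideanSpace ℝ (Fin m)) p).source)
    (v : TangentSpace (𝓡 m) p') : ((tangentTriv p) ⟨p', v⟩).2 =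
      mfderiv (𝓡 m) 𝓘(ℝ, EuclideanSpace ℝ (Fin m)) (extChartAt (𝓡 m) p) p' v := by
  have hb : p' ∈ (tangentTriv (m := m) p).baseSet := by
    rwa [TangentBundle.trivializationAt_baseSet]
  have h1 := DFunLike.congr_fun (TangentBundle.continuousLinearMapAt_trivializationAt
    (I := 𝓡 m) hp') v
  refine Eq.trans ?_ h1
  rw [Bundle.Trivialization.continuousLinearMapAt_apply,
    (tangentTriv (m := m) p).coe_linearMapAt_of_mem hb]

/-- Identifies the bundle extension of a vector with the field of constant coefficients in the chart
at `p`, which makes brackets and second derivatives computable. -/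
lemma extend_eq_mfderivWithin {p p' : S} (hp' : p' ∈ (chartAt (EuclideanSpace ℝ (Fin m)) p).source)
    (v : TangentSpace (𝓡 m) p) :
    FiberBundle.extend (EuclideanSpace ℝ (Fin m)) v p' =
      mfderivWithin 𝓘(ℝ, EuclideanSpace ℝ (Fin m)) (𝓡 m) (extChartAt (𝓡 m) p).symm
        (Set.range (𝓡 m)) (extChartAt (𝓡 m) p p') ((tangentTriv p) ⟨p, v⟩).2 := by
  rw [← TangentBundle.symmL_trivializationAt hp']
  exact ((tangentTriv p).symmL_apply (R := ℝ) (by rwa [TangentBundle.trivializationAt_baseSet]) _).symm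

/-- The Lie bracket of two local extensions of tangent vectors with constant coefficients in a chart
vanishes. -/
lemma mlieBracket_extend (p : S) (u v : TangentSpace (𝓡 m) p) :
    mlieBracket (𝓡 m) (FiberBundle.extend (EuclideanSpace ℝ (Fin m)) u)
      (FiberBundle.extend (EuclideanSpace ℝ (Fin m)) v) p = 0 := by
  have key : ∀ w : TangentSpace (𝓡 m) p,
      mpullbackWithin 𝓘(ℝ, EuclideanSpace ℝ (Fin m)) (𝓡 m) (extChartAt (𝓡 m) p).symm
        (FiberBundle.extend (EuclideanSpace ℝ (Fin m)) w) (Set.range (𝓡 m))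
        =ᶠ[𝓝 (extChartAt (𝓡 m) p p)] fun _ ↦ ((tangentTriv p) ⟨p, w⟩).2 := fun w ↦ by
    filter_upwards [extChartAt_target_mem_nhds (I := 𝓡 m) p] with z hz
    have hs := (extChartAt (𝓡 m) p).map_target hz
    rw [extChartAt_source] at hs
    rw [mpullbackWithin_apply, extend_eq_mfderivWithin hs, (extChartAt (𝓡 m) p).right_inv hz]
    exact (isInvertible_mfderivWithin_extChartAt_symm hz).inverse_apply_self _
  have h0 : ∀ w : TangentSpace (𝓡 m) p, ∀ s,
      fderivWithin ℝ (mpullbackWithin 𝓘(ℝ, EuclideanSpace ℝ (Fin m)) (𝓡 m) (extChartAt (𝓡 m) p).symm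
        (FiberBundle.extend (EuclideanSpace ℝ (Fin m)) w) (Set.range (𝓡 m))) s
        (extChartAt (𝓡 m) p p) = 0 := fun w s ↦ by
    rw [((key w).filter_mono nhdsWithin_le_nhds).fderivWithin_eq (key w).self_of_nhds]
    simp
  rw [← mlieBracketWithin_univ, mlieBracketWithin_apply]
  unfold lieBracketWithin
  rw [h0, h0]
  refine (congrArg _ (sub_self (0 : EuclideanSpace ℝ (Fin m)))).trans ?_
  exact map_zero _

variable {n : ℕ}

/-- Every tangent vector extends to a global smooth vector field. -/
lemma exists_smoothVF_eventuallyEq_extend [T2Space S] (p : S) (v : TangentSpace (𝓡 m) p) :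
    ∃ A ∈ smoothVF m S, ∀ᶠ q in 𝓝 p, A q = FiberBundle.extend (EuclideanSpace ℝ (Fin m)) v q := by
  obtain ⟨s, hs, hsm⟩ := FiberBundle.exists_contMDiffOn_extend (k := ∞) (𝓡 m)
    (EuclideanSpace ℝ (Fin m)) v
  obtain ⟨ψ, -, hψ⟩ := (SmoothBumpFunction.nhds_basis_tsupport (I := 𝓡 m) p).mem_iff.1
    (interior_mem_nhds.2 hs)
  refine ⟨(ψ : S → ℝ) • FiberBundle.extend (EuclideanSpace ℝ (Fin m)) v,
    ContMDiffOn.smul_section_of_tsupport ψ.contMDiff.contMDiffOn isOpen_interior hψ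
      (hsm.mono interior_subset), ?_⟩
  filter_upwards [ψ.eventuallyEq_one] with q hq
  simp [Pi.smul_apply', hq]

variable {M : Type*} [TopologicalSpace M] [ChartedSpace (EuclideanSpace ℝ (Fin n)) M]
  [IsManifold (𝓡 n) ∞ M]

/-- The derivative of a map written in charts. -/
lemma fderiv_writtenInExtChartAt {f : M → S} (hf : ContMDiff (𝓡 n) (𝓡 m) ∞ f) {q q' : M}
    {z : EuclideanSpace ℝ (Fin n)} (hz : z ∈ (extChartAt (𝓡 n) q).target)
    (hq' : (extChartAt (𝓡 n) q).symm z = q')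
    (hfq' : f q' ∈ (chartAt (EuclideanSpace ℝ (Fin m)) (f q)).source)
    (w : EuclideanSpace ℝ (Fin n)) :
    fderiv ℝ (extChartAt (𝓡 m) (f q) ∘ f ∘ (extChartAt (𝓡 n) q).symm) z w =
      mfderiv (𝓡 m) 𝓘(ℝ, EuclideanSpace ℝ (Fin m)) (extChartAt (𝓡 m) (f q)) (f q')
        (mfderiv (𝓡 n) (𝓡 m) f q' (mfderivWithin 𝓘(ℝ, EuclideanSpace ℝ (Fin n)) (𝓡 n)
          (extChartAt (𝓡 n) q).symm (Set.range (𝓡 n)) z w)) := by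
  subst hq'
  have h1 := (mdifferentiableWithinAt_extChartAt_symm (I := 𝓡 n) hz)
  rw [ModelWithCorners.range_eq_univ, mdifferentiableWithinAt_univ] at h1
  have h2 := (((hf _).mdifferentiableAt (by simp)).hasMFDerivAt).comp _ h1.hasMFDerivAt
  have h3 := (mdifferentiableAt_extChartAt (I := 𝓡 m) hfq').hasMFDerivAt.comp z h2
  rw [← mfderiv_eq_fderiv, h3.mfderiv, ModelWithCorners.range_eq_univ, mfderivWithin_univ]
  rfl

/-- The derivative of the image under `f` of a field with constant coefficients in a chart is given
by the second derivative of `f` in charts. -/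
lemma mvfderiv_mfderiv_extend {f : M → S} (hf : ContMDiff (𝓡 n) (𝓡 m) ∞ f) (q : M)
    (a b : TangentSpace (𝓡 n) q) {A : Π q : M, TangentSpace (𝓡 n) q}
    (hA : ∀ᶠ q' in 𝓝 q, A q' = FiberBundle.extend (EuclideanSpace ℝ (Fin n)) a q') :
    mvfderiv (𝓡 n) (fun q' ↦ ((tangentTriv (f q)) ⟨f q', mfderiv (𝓡 n) (𝓡 m) f q' (A q')⟩).2) q b =
      fderiv ℝ (fderiv ℝ (extChartAt (𝓡 m) (f q) ∘ f ∘ (extChartAt (𝓡 n) q).symm))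
        (extChartAt (𝓡 n) q q) ((tangentTriv q) ⟨q, b⟩).2 ((tangentTriv q) ⟨q, a⟩).2 := by
  set g := extChartAt (𝓡 m) (f q) ∘ f ∘ (extChartAt (𝓡 n) q).symm with hg
  set e := extChartAt (𝓡 n) q with he
  have hgs : ContDiffAt ℝ ∞ g (e q) := by
    have := (contMDiffAt_iff.1 (hf q)).2
    rwa [ModelWithCorners.range_eq_univ, contDiffWithinAt_univ] at this
  -- With constant coefficients the coordinates of `df(A)` are a first derivative of `g` in a fixed
  -- direction, so differentiating once more gives `D²g`.
  have hy : (fun q' ↦ ((tangentTriv (f q)) ⟨f q', mfderiv (𝓡 n) (𝓡 m) f q' (A q')⟩).2) =ᶠ[𝓝 q]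
      (fun z ↦ fderiv ℝ g z ((tangentTriv q) ⟨q, a⟩).2) ∘ e := by
    filter_upwards [hA, chart_source_mem_nhds (EuclideanSpace ℝ (Fin n)) q,
      hf.continuous.continuousAt.preimage_mem_nhds
        (chart_source_mem_nhds (EuclideanSpace ℝ (Fin m)) (f q))] with q' hAq' hq' hfq'
    have hz : e q' ∈ e.target := e.map_source (by rwa [he, extChartAt_source])
    refine (tangentTriv_apply hfq' _).trans ?_
    refine Eq.trans ?_ (fderiv_writtenInExtChartAt hf hz (e.left_inv (by rwa [he, extChartAt_source]))
      hfq' _).symm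
    rw [hAq', extend_eq_mfderivWithin hq']
  rw [mvfderiv_eq_of_eventuallyEq hy b]
  have hd : DifferentiableAt ℝ (fderiv ℝ g) (e q) :=
    (hgs.fderiv_right (m := 1) (show ((2 : ℕ∞) : ℕ∞ω) ≤ ∞ from WithTop.coe_le_coe.2 le_top)).differentiableAt one_ne_zero
  have hd' : HasFDerivAt (fun z ↦ fderiv ℝ g z ((tangentTriv q) ⟨q, a⟩).2)
      ((fderiv ℝ (fderiv ℝ g) (e q)).flip ((tangentTriv q) ⟨q, a⟩).2) (e q) := by
    simpa using hd.hasFDerivAt.clm_apply (hasFDerivAt_const ((tangentTriv q) ⟨q, a⟩).2 (e q))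
  have hτ := tangentTriv_apply (mem_chart_source _ q) b
  have h6 := mfderiv_eq_fderiv (𝕜 := ℝ) (f := fun z ↦ fderiv ℝ g z ((tangentTriv q) ⟨q, a⟩).2) (x := e q)
  rw [hd'.fderiv] at h6
  refine (DFunLike.congr_fun (mfderiv_comp q hd'.differentiableAt.mdifferentiableAt
    (mdifferentiableAt_extChartAt (I := 𝓡 n) (mem_chart_source _ q))) b).trans ?_
  refine (DFunLike.congr_fun h6 _).trans ?_
  rw [hτ]
  rfl

/-- The torsion of the connection on vectors tangent to a submanifold. -/
lemma torsion_mfderiv {f : M → S} (hf : ContMDiff (𝓡 n) (𝓡 m) ∞ f) (cov : AffineConnection m S)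
    (q : M) (a b : TangentSpace (𝓡 n) q) {A B : Π q : M, TangentSpace (𝓡 n) q}
    (hA : ∀ᶠ q' in 𝓝 q, A q' = FiberBundle.extend (EuclideanSpace ℝ (Fin n)) a q')
    (hB : ∀ᶠ q' in 𝓝 q, B q' = FiberBundle.extend (EuclideanSpace ℝ (Fin n)) b q') :
    cov.torsion (f q) (mfderiv (𝓡 n) (𝓡 m) f q a) (mfderiv (𝓡 n) (𝓡 m) f q b) =
      covAlong cov f (fun q' ↦ mfderiv (𝓡 n) (𝓡 m) f q' (B q')) q a -
        covAlong cov f (fun q' ↦ mfderiv (𝓡 n) (𝓡 m) f q' (A q')) q b := by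
  have hAq : A q = a := by rw [hA.self_of_nhds, FiberBundle.extend_apply_self]
  have hBq : B q = b := by rw [hB.self_of_nhds, FiberBundle.extend_apply_self]
  rw [covAlong_eq (mvfderiv_mfderiv_extend hf q b a hB),
    covAlong_eq (mvfderiv_mfderiv_extend hf q a b hA), hAq, hBq,
    CovariantDerivative.torsion_apply_eq_extend, mlieBracket_extend]
  -- The coordinate terms of the two induced derivatives are `D²g(a, b)` and `D²g(b, a)`; they
  -- cancel, leaving the torsion computed with extensions whose bracket is zero.
  have hsymm : IsSymmSndFDerivAt ℝ (extChartAt (𝓡 m) (f q) ∘ f ∘ (extChartAt (𝓡 n) q).symm)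
      (extChartAt (𝓡 n) q q) := by
    have := (contMDiffAt_iff.1 (hf q)).2
    rw [ModelWithCorners.range_eq_univ, contDiffWithinAt_univ] at this
    refine this.isSymmSndFDerivAt ?_
    rw [minSmoothness_of_isRCLikeNormedField]
    exact show ((2 : ℕ∞) : ℕ∞ω) ≤ ∞ from WithTop.coe_le_coe.2 le_top
  rw [hsymm.eq]
  simp

/-- The torsion preserves the tangent spaces of an autoparallel submanifold. -/
theorem torsion_mem_tangentOf [T2Space S] {cov : AffineConnection m S} {M : Set S}
    [ChartedSpace (EuclideanSpace ℝ (Fin n)) M] [IsManifold (𝓡 n) ∞ M]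
    (hM : IsSubmanifold m n M) (ha : IsAutoparallel cov n M) (q : M)
    {u v : TangentSpace (𝓡 m) (q : S)} (hu : u ∈ tangentOf m n M q) (hv : v ∈ tangentOf m n M q) :
    cov.torsion q u v ∈ tangentOf m n M q := by
  obtain ⟨a, rfl⟩ := hu
  obtain ⟨b, rfl⟩ := hv
  obtain ⟨A, hA, hAe⟩ := exists_smoothVF_eventuallyEq_extend q a
  obtain ⟨B, hB, hBe⟩ := exists_smoothVF_eventuallyEq_extend q b
  have hAq : A q = a := by rw [hAe.self_of_nhds, FiberBundle.extend_apply_self]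
  have hBq : B q = b := by rw [hBe.self_of_nhds, FiberBundle.extend_apply_self]
  have h := torsion_mfderiv hM.contMDiff cov q a b hAe hBe
  have h1 := ha A hA B hB q
  have h2 := ha B hB A hA q
  rw [hAq] at h1
  rw [hBq] at h2
  have := (tangentOf m n M q).sub_mem h1 h2
  rw [← h] at this
  exact this

end Torsion

/-! ### From torsion to involutivity. -/

section Involutive

open VectorField

variable {m : ℕ} {S : Type*} [TopologicalSpace S] [ChartedSpace (EuclideanSpace ℝ (Fin m)) S]
  [IsManifold (𝓡 m) ∞ S] {X : Fin m → Π p : S, TangentSpace (𝓡 m) p} {cov : AffineConnection m S}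
  {V : Π p : S, Submodule ℝ (TangentSpace (𝓡 m) p)} {V₀ : Submodule ℝ (EuclideanSpace ℝ (Fin m))}

lemma mlieBracket_mem_smoothVF {Y Z : Π p : S, TangentSpace (𝓡 m) p} (hY : Y ∈ smoothVF m S)
    (hZ : Z ∈ smoothVF m S) : mlieBracket (𝓡 m) Y Z ∈ smoothVF m S := by
  have : IsManifold (𝓡 m) (((⊤ : ℕ∞) : ℕ∞ω) + 1) S := ‹IsManifold (𝓡 m) ∞ S›
  have : IsManifold (𝓡 m) (minSmoothness ℝ 2) S := by
    rw [minSmoothness_of_isRCLikeNormedField]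
    infer_instance
  refine fun p ↦ ContMDiffAt.mlieBracket_vectorField (n := ⊤) (m := ⊤) (hY p) (hZ p) ?_
  rw [minSmoothness_of_isRCLikeNormedField]
  exact le_rfl

/-- The bracket of two fields in terms of covariant derivatives and of the torsion. -/
lemma mlieBracket_eq {Y Z : Π p : S, TangentSpace (𝓡 m) p} (hY : Y ∈ smoothVF m S)
    (hZ : Z ∈ smoothVF m S) (p : S) :
    mlieBracket (𝓡 m) Y Z p = cov Z p (Y p) - cov Y p (Z p) - cov.torsion p (Y p) (Z p) := by
  rw [cov.torsion_apply (mdifferentiableAt_of_mem_smoothVF hY p)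
    (mdifferentiableAt_of_mem_smoothVF hZ p), sub_sub_cancel]

/-- The case of the identity map in `covAlong_mem`. -/
lemma cov_mem (hX : ∀ i, X i ∈ parallelVF cov) (hli : ∀ p, LinearIndependent ℝ fun i ↦ X i p)
    (hV₀ : ∀ p, V p = V₀.map (frameMap X p).toLinearMap) {Y : Π p : S, TangentSpace (𝓡 m) p}
    (hY : Y ∈ smoothVFIn V) (p : S) (u : TangentSpace (𝓡 m) p) : cov Y p u ∈ V p := by
  have h := covAlong_comp cov (fun p : S ↦ p) Y p mdifferentiableAt_id
    (mdifferentiableAt_of_mem_smoothVF hY.1 p) u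
  have h2 := covAlong_mem hX hli hV₀ (f := fun p : S ↦ p) (Y := Y) (q := p) mdifferentiableAt_id
    (mdifferentiableAt_of_mem_smoothVF hY.1 p) hY.2 u
  have h3 : mfderiv (𝓡 m) (𝓡 m) (fun p : S ↦ p) p u = u :=
    DFunLike.congr_fun (mfderiv_id (I := 𝓡 m) (x := p)) u
  rw [h, h3] at h2
  exact h2

/-- Each of the three terms of `[Y, Z] = ∇_Y Z - ∇_Z Y - T(Y, Z)` lies in `V`. -/
lemma bracket_mem_of_torsion_mem (hX : ∀ i, X i ∈ parallelVF cov)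
    (hli : ∀ p, LinearIndependent ℝ fun i ↦ X i p)
    (hV₀ : ∀ p, V p = V₀.map (frameMap X p).toLinearMap)
    (h : ∀ p : S, ∀ u ∈ V p, ∀ v ∈ V p, cov.torsion p u v ∈ V p)
    {Y Z : Π p : S, TangentSpace (𝓡 m) p} (hY : Y ∈ smoothVFIn V) (hZ : Z ∈ smoothVFIn V) :
    mlieBracket (𝓡 m) Y Z ∈ smoothVFIn V := by
  refine ⟨mlieBracket_mem_smoothVF hY.1 hZ.1, fun p ↦ ?_⟩
  rw [mlieBracket_eq (cov := cov) hY.1 hZ.1]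
  exact (V p).sub_mem ((V p).sub_mem (cov_mem hX hli hV₀ hZ p _) (cov_mem hX hli hV₀ hY p _))
    (h p _ (hY.2 p) _ (hZ.2 p))

end Involutive

/-! ### Slices of charts as embedded submanifolds. -/

section Slice

open IsManifold

variable {m n : ℕ} {S : Type*} [TopologicalSpace S] [ChartedSpace (EuclideanSpace ℝ (Fin m)) S]
  {K : Type} [NormedAddCommGroup K] [NormedSpace ℝ K]
  {κ : OpenPartialHomeomorph S (EuclideanSpace ℝ (Fin m))}
  {L : (EuclideanSpace ℝ (Fin n) × K) ≃L[ℝ] EuclideanSpace ℝ (Fin m)}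

section

variable {M : Set S} [ChartedSpace (EuclideanSpace ℝ (Fin n)) M]
  {e : OpenPartialHomeomorph M (EuclideanSpace ℝ (Fin n))}

/-- A subset which is a slice in a chart is a submanifold. -/
lemma isSubmanifold_of_slice (hκ : κ ∈ maximalAtlas (𝓡 m) ∞ S) (he : e ∈ maximalAtlas (𝓡 n) ∞ M)
    (hsource : e.source = Set.univ) (hκM : ∀ q : M, (q : S) ∈ κ.source)
    (heκ : ∀ q : M, κ q = L (e q, 0)) : IsSubmanifold m n M := by
  refine ⟨Manifold.IsImmersionOfComplement.isImmersion (F := K) fun q ↦ ?_, .subtypeVal⟩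
  refine Manifold.IsImmersionAtOfComplement.mk_of_charts L e κ (by simp [hsource]) (hκM q) he hκ
    (fun q _ ↦ hκM q) fun x hx ↦ ?_
  have hx' : x ∈ e.target := by simpa using hx
  have := heκ (e.symm x)
  rw [e.right_inv hx'] at this
  simpa using this

/-- The tangent spaces of a slice. -/
lemma tangentOf_eq_of_slice (hκ : κ ∈ maximalAtlas (𝓡 m) ∞ S) (he : e ∈ maximalAtlas (𝓡 n) ∞ M)
    (hsource : e.source = Set.univ) (hκM : ∀ q : M, (q : S) ∈ κ.source)
    (heκ : ∀ q : M, κ q = L (e q, 0)) {f : EuclideanSpace ℝ (Fin n) → S}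
    (hf : ∀ q : M, MDifferentiableAt (𝓡 n) (𝓡 m) f (e q)) (hfe : ∀ q : M, f (e q) = q) (q : M) :
    tangentOf m n M q = LinearMap.range (mfderiv (𝓡 n) (𝓡 m) f (e q)).toLinearMap := by
  have hval : MDifferentiableAt (𝓡 n) (𝓡 m) (Subtype.val : M → S) q :=
    (isSubmanifold_of_slice hκ he hsource hκM heκ).contMDiff q |>.mdifferentiableAt (by simp)
  have hq : q ∈ e.source := by simp [hsource]
  have hed : MDifferentiableAt (𝓡 n) (𝓡 n) e q :=
    (contMDiffOn_of_mem_maximalAtlas he q hq).contMDiffAt (e.open_source.mem_nhds hq)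
      |>.mdifferentiableAt (by simp)
  have hesd : MDifferentiableAt (𝓡 n) (𝓡 n) e.symm (e q) :=
    (contMDiffOn_symm_of_mem_maximalAtlas he (e q) (e.map_source hq)).contMDiffAt
      (e.open_target.mem_nhds (e.map_source hq)) |>.mdifferentiableAt (by simp)
  have h1 : (Subtype.val : M → S) = f ∘ e := funext fun q ↦ (hfe q).symm
  have h2 : f =ᶠ[𝓝 (e q)] Subtype.val ∘ e.symm := by
    filter_upwards [e.open_target.mem_nhds (e.map_source hq)] with x hx
    have := hfe (e.symm x)
    rwa [e.right_inv hx] at this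
  have h3 := mfderiv_comp q (hf q) hed
  have h4 := mfderiv_comp_of_eq (f := e.symm) (x := e q) hval hesd (e.left_inv hq)
  rw [← h1] at h3
  rw [← h2.mfderiv_eq] at h4
  apply le_antisymm
  · rintro _ ⟨a, rfl⟩
    exact ⟨_, (DFunLike.congr_fun h3 a).symm⟩
  · rintro _ ⟨a, rfl⟩
    -- The derivative is taken at `e.symm (e q)`, which is only propositionally `q`; a general `q'`
    -- permits substitution.
    have h5 : ∀ q' : M, q' = q → ∀ b : EuclideanSpace ℝ (Fin n),
        (mfderiv (𝓡 n) (𝓡 m) (Subtype.val : M → S) q' b : EuclideanSpace ℝ (Fin m)) ∈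
          tangentOf m n M q := by
      rintro q' rfl b
      exact ⟨b, rfl⟩
    exact (congrArg (· ∈ tangentOf m n M q) (DFunLike.congr_fun h4 a)).mpr (h5 _ (e.left_inv hq) _)

end

/-- A slice in a chart carries the structure of a submanifold. -/
lemma exists_slice (hκ : κ ∈ maximalAtlas (𝓡 m) ∞ S) {B : Set (EuclideanSpace ℝ (Fin n))}
    (hB : IsOpen B) (hBn : B.Nonempty) (hBκ : ∀ x ∈ B, L (x, 0) ∈ κ.target) :
    ∃ (M : Set S) (_ : ChartedSpace (EuclideanSpace ℝ (Fin n)) M) (_ : IsManifold (𝓡 n) ∞ M),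
      (∀ x ∈ B, κ.symm (L (x, 0)) ∈ M) ∧ IsSubmanifold m n M ∧ ∀ q : M, ∃ x ∈ B,
        κ.symm (L (x, 0)) = q ∧ tangentOf m n M q =
          LinearMap.range (mfderiv (𝓡 n) (𝓡 m) (fun x ↦ κ.symm (L (x, 0))) x).toLinearMap := by
  set f : EuclideanSpace ℝ (Fin n) → S := fun x ↦ κ.symm (L (x, 0)) with hf
  have hκf : ∀ x ∈ B, κ (f x) = L (x, 0) := fun x hx ↦ κ.right_inv (hBκ x hx)
  have hκs : ∀ q : f '' B, (q : S) ∈ κ.source := by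
    rintro ⟨_, x, hx, rfl⟩
    exact κ.map_target (hBκ x hx)
  have hcf : ∀ x ∈ B, (L.symm (κ (f x))).1 = x := fun x hx ↦ by simp [hκf x hx]
  let c : f '' B ≃ₜ B :=
    { toFun := fun q ↦ ⟨(L.symm (κ q)).1, by
        obtain ⟨_, x, hx, rfl⟩ := q
        rwa [hcf x hx]⟩
      invFun := fun x ↦ ⟨f x, x, x.2, rfl⟩
      left_inv := by
        rintro ⟨_, x, hx, rfl⟩
        simp [hcf x hx]
      right_inv := fun x ↦ Subtype.ext (hcf x x.2)
      continuous_toFun := by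
        refine Continuous.subtype_mk (continuous_fst.comp (L.symm.continuous.comp ?_)) _
        exact κ.continuousOn.comp_continuous continuous_subtype_val hκs
      continuous_invFun := by
        refine Continuous.subtype_mk (κ.continuousOn_symm.comp_continuous ?_ fun x : B ↦ hBκ x x.2) _
        fun_prop }
  -- The inverse of the parametrization is an open embedding into the model space and serves as the
  -- only chart.
  have hc : Topology.IsOpenEmbedding (Subtype.val ∘ c) :=
    hB.isOpenEmbedding_subtypeVal.comp c.isOpenEmbedding
  have : Nonempty (f '' B) := (hBn.image f).to_subtype
  let _ := hc.singletonChartedSpace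
  have hM : IsManifold (𝓡 n) ∞ (f '' B) := hc.isManifold_singleton
  set e := hc.toOpenPartialHomeomorph with he
  have heM : e ∈ maximalAtlas (𝓡 n) ∞ (f '' B) :=
    chart_mem_maximalAtlas (I := 𝓡 n) (Classical.arbitrary (f '' B))
  have hes : e.source = Set.univ := hc.toOpenPartialHomeomorph_source
  have heq : ∀ q : f '' B, ∃ x ∈ B, f x = q ∧ e q = x := by
    rintro ⟨_, x, hx, rfl⟩
    exact ⟨x, hx, rfl, hcf x hx⟩
  have heκ : ∀ q : f '' B, κ q = L (e q, 0) := fun q ↦ by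
    obtain ⟨x, hx, h1, h2⟩ := heq q
    rw [h2, ← h1, hκf x hx]
  have hfd : ∀ x ∈ B, MDifferentiableAt (𝓡 n) (𝓡 m) f x := fun x hx ↦ by
    have h1 : MDifferentiableAt (𝓡 m) (𝓡 m) κ.symm (L (x, 0)) :=
      (contMDiffOn_symm_of_mem_maximalAtlas hκ _ (hBκ x hx)).contMDiffAt
        (κ.open_target.mem_nhds (hBκ x hx)) |>.mdifferentiableAt (by simp)
    have h2 : DifferentiableAt ℝ (fun x ↦ L (x, 0)) x := by fun_prop
    exact h1.comp x h2.mdifferentiableAt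
  refine ⟨f '' B, inferInstance, hM, fun x hx ↦ ⟨x, hx, rfl⟩,
    isSubmanifold_of_slice hκ heM hes hκs heκ, fun q ↦ ?_⟩
  obtain ⟨x, hx, h1, h2⟩ := heq q
  refine ⟨x, hx, h1, ?_⟩
  rw [← h2]
  refine tangentOf_eq_of_slice hκ heM hes hκs heκ (fun q ↦ ?_) (fun q ↦ ?_) q
  · obtain ⟨x, hx, h1, h2⟩ := heq q
    rw [h2]
    exact hfd x hx
  · obtain ⟨x, hx, h1, h2⟩ := heq q
    rw [h2, h1]

end Slice

/-! ### Integral manifolds of parallel distributions. -/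

section IntegralManifold

open VectorField IsManifold Metric

variable {m n : ℕ} {S : Type*} [TopologicalSpace S] [ChartedSpace (EuclideanSpace ℝ (Fin m)) S]
  [IsManifold (𝓡 m) ∞ S]

/-- A frame, written in the chart at `p`. -/
def chartFrame (X : Fin m → Π p : S, TangentSpace (𝓡 m) p) (p : S) (z : EuclideanSpace ℝ (Fin m)) :
    EuclideanSpace ℝ (Fin m) →L[ℝ] EuclideanSpace ℝ (Fin m) :=
  (mfderiv (𝓡 m) (𝓡 m) (extChartAt (𝓡 m) p).symm z).inverse.comp
    (frameMap X ((extChartAt (𝓡 m) p).symm z))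

variable {X : Fin m → Π p : S, TangentSpace (𝓡 m) p} {p : S} {z : EuclideanSpace ℝ (Fin m)}

lemma contMDiffAt_chart_symm (hz : z ∈ (extChartAt (𝓡 m) p).target) :
    ContMDiffAt (𝓡 m) (𝓡 m) ∞ (extChartAt (𝓡 m) p).symm z :=
  (contMDiffOn_extChartAt_symm p).contMDiffAt
    ((isOpen_extChartAt_target (I := 𝓡 m) p).mem_nhds hz)

lemma isInvertible_mfderiv_chart_symm (hz : z ∈ (extChartAt (𝓡 m) p).target) :
    (mfderiv (𝓡 m) (𝓡 m) (extChartAt (𝓡 m) p).symm z).IsInvertible := by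
  have := isInvertible_mfderivWithin_extChartAt_symm (I := 𝓡 m) hz
  rwa [ModelWithCorners.range_eq_univ, mfderivWithin_univ] at this

lemma mfderiv_chartFrame (hz : z ∈ (extChartAt (𝓡 m) p).target) (c : EuclideanSpace ℝ (Fin m)) :
    mfderiv (𝓡 m) (𝓡 m) (extChartAt (𝓡 m) p).symm z (chartFrame X p z c) =
      frameMap X ((extChartAt (𝓡 m) p).symm z) c :=
  (isInvertible_mfderiv_chart_symm hz).self_apply_inverse _

lemma chartFrame_injective (hli : ∀ p, LinearIndependent ℝ fun i ↦ X i p)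
    (hz : z ∈ (extChartAt (𝓡 m) p).target) : Function.Injective (chartFrame X p z) := by
  intro c d h
  refine frameMap_injective (hli ((extChartAt (𝓡 m) p).symm z)) ?_
  rw [← mfderiv_chartFrame hz, h, mfderiv_chartFrame hz]

variable {cov : AffineConnection m S}

lemma contDiffAt_chartFrame_apply (hX : ∀ i, X i ∈ parallelVF cov)
    (hz : z ∈ (extChartAt (𝓡 m) p).target) (c : EuclideanSpace ℝ (Fin m)) :
    ContDiffAt ℝ ∞ (fun z ↦ chartFrame X p z c) z := by
  have h1 := (frameMap_mem_parallelVF hX c).1 ((extChartAt (𝓡 m) p).symm z)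
  have h2 := ContMDiffAt.mpullback_vectorField_preimage (n := ∞) h1 (contMDiffAt_chart_symm hz)
    (isInvertible_mfderiv_chart_symm hz) le_rfl
  exact contMDiffAt_vectorSpace_iff_contDiffAt.1 h2

lemma contDiffOn_chartFrame (hX : ∀ i, X i ∈ parallelVF cov) (p : S) :
    ContDiffOn ℝ ∞ (chartFrame X p) (extChartAt (𝓡 m) p).target :=
  contDiffOn_clm_apply.2 fun c _ hz ↦ (contDiffAt_chartFrame_apply hX hz c).contDiffWithinAt

/-- The fields `z ↦ chartFrame X p z a` are pullbacks of parallel fields. Pullback commutes with the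
bracket, which in a vector space is `DB(A) - DA(B)`. This converts the bracket condition into the
hypothesis of `exists_integral_section`. -/
lemma fderiv_chartFrame_sub (hX : ∀ i, X i ∈ parallelVF cov)
    (hz : z ∈ (extChartAt (𝓡 m) p).target) (a b : EuclideanSpace ℝ (Fin m)) :
    fderiv ℝ (chartFrame X p) z (chartFrame X p z a) b -
      fderiv ℝ (chartFrame X p) z (chartFrame X p z b) a =
    mpullback (𝓡 m) (𝓡 m) (extChartAt (𝓡 m) p).symm
      (mlieBracket (𝓡 m) (fun q ↦ frameMap X q a) (fun q ↦ frameMap X q b)) z := by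
  have : IsManifold (𝓡 m) (minSmoothness ℝ 3) S := by
    rw [minSmoothness_of_isRCLikeNormedField]
    exact IsManifold.of_le (n := ∞) (show ((3 : ℕ∞) : ℕ∞ω) ≤ ∞ from WithTop.coe_le_coe.2 le_top)
  have hd : DifferentiableAt ℝ (chartFrame X p) z :=
    ((contDiffOn_chartFrame hX p).differentiableOn (by simp)).differentiableAt
      ((isOpen_extChartAt_target (I := 𝓡 m) p).mem_nhds hz)
  have hdc : ∀ c u, fderiv ℝ (fun z ↦ chartFrame X p z c) z u =
      fderiv ℝ (chartFrame X p) z u c := fun c u ↦ by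
    rw [fderiv_clm_apply hd (differentiableAt_const c)]
    simp
  have hs := fun c ↦ mdifferentiableAt_of_mem_smoothVF (frameMap_mem_parallelVF hX c).1
    ((extChartAt (𝓡 m) p).symm z)
  have hl : ∀ A B : Π z : EuclideanSpace ℝ (Fin m), TangentSpace (𝓡 m) z,
      mlieBracket (𝓡 m) A B z = lieBracket ℝ A B z := fun A B ↦ by
    rw [← mlieBracketWithin_univ]
    exact (congrFun mlieBracketWithin_eq_lieBracketWithin z).trans (congrFun lieBracketWithin_univ z)
  rw [mpullback_mlieBracket (n := ∞) (hs a) (hs b) (contMDiffAt_chart_symm hz) (by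
    rw [minSmoothness_of_isRCLikeNormedField]
    exact show ((2 : ℕ∞) : ℕ∞ω) ≤ ∞ from WithTop.coe_le_coe.2 le_top), ← hdc, ← hdc]
  exact (hl (mpullback (𝓡 m) (𝓡 m) (extChartAt (𝓡 m) p).symm fun x ↦ frameMap X x a)
    (mpullback (𝓡 m) (𝓡 m) (extChartAt (𝓡 m) p).symm fun x ↦ frameMap X x b)).symm

variable {V : Π p : S, Submodule ℝ (TangentSpace (𝓡 m) p)}
  {V₀ : Submodule ℝ (EuclideanSpace ℝ (Fin m))}

/-- An integral manifold of a parallel distribution is autoparallel. -/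
lemma isAutoparallel_of_tangentOf_eq (hX : ∀ i, X i ∈ parallelVF cov)
    (hli : ∀ p, LinearIndependent ℝ fun i ↦ X i p)
    (hV₀ : ∀ p, V p = V₀.map (frameMap X p).toLinearMap) {M : Set S}
    [ChartedSpace (EuclideanSpace ℝ (Fin n)) M] [IsManifold (𝓡 n) ∞ M] (hM : IsSubmanifold m n M)
    (hT : ∀ q : M, tangentOf m n M q = V q) : IsAutoparallel cov n M := by
  intro A _ Y hY q
  rw [hT]
  refine covAlong_mem hX hli hV₀ (hM.contMDiff q |>.mdifferentiableAt (by simp)) ?_ (fun q' ↦ ?_) _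
  · have h := (hM.contMDiff.contMDiff_tangentMap (m := ∞) le_rfl).comp hY
    exact (h q).mdifferentiableAt (by simp)
  · rw [← hT]
    exact ⟨_, rfl⟩

/-- **Frobenius theorem** for a distribution spanned by a part of a parallel frame. -/
theorem exists_integral_manifold (hX : ∀ i, X i ∈ parallelVF cov)
    (hli : ∀ p, LinearIndependent ℝ fun i ↦ X i p)
    (hV₀ : ∀ p, V p = V₀.map (frameMap X p).toLinearMap) (hn : ∀ p, Module.finrank ℝ (V p) = n)
    (h : ∀ Y ∈ parallelVFIn cov V, ∀ Z ∈ parallelVFIn cov V,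
      mlieBracket (𝓡 m) Y Z ∈ smoothVFIn V) (p : S) :
    ∃ (M : Set S) (_ : ChartedSpace (EuclideanSpace ℝ (Fin n)) M) (_ : IsManifold (𝓡 n) ∞ M)
      (_ : p ∈ M), IsSubmanifold m n M ∧ ∀ q : M, tangentOf m n M q = V q := by
  have hfin : Module.finrank ℝ V₀ = n := by
    rw [← hn p, hV₀ p]
    exact (LinearEquiv.finrank_eq (Submodule.equivMapOfInjective _
      (frameMap_injective (hli p)) V₀))
  have i : EuclideanSpace ℝ (Fin n) ≃L[ℝ] V₀ :=
    ContinuousLinearEquiv.ofFinrankEq (by rw [hfin, finrank_euclideanSpace_fin])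
  have hpar : ∀ c ∈ V₀, (fun p ↦ frameMap X p c) ∈ parallelVFIn cov V := fun c hc ↦
    ⟨⟨(frameMap_mem_parallelVF hX c).1, fun q ↦ by rw [hV₀]; exact ⟨c, hc, rfl⟩⟩,
      frameMap_mem_parallelVF hX c⟩
  have hinv : ∀ z ∈ (extChartAt (𝓡 m) p).target, ∀ a ∈ V₀, ∀ b ∈ V₀,
      fderiv ℝ (chartFrame X p) z (chartFrame X p z a) b -
        fderiv ℝ (chartFrame X p) z (chartFrame X p z b) a ∈
          V₀.map (chartFrame X p z).toLinearMap := by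
    intro z hz a ha b hb
    rw [fderiv_chartFrame_sub hX hz]
    have h1 := (h _ (hpar a ha) _ (hpar b hb)).2 ((extChartAt (𝓡 m) p).symm z)
    rw [hV₀] at h1
    obtain ⟨c, hc, hce⟩ := h1
    refine ⟨c, hc, ?_⟩
    rw [mpullback_apply, ← hce]
    rfl
  obtain ⟨r, hr, f, P, j, hPj, hf0, hfU, hfs, hPf, hrange⟩ := exists_integral_section
    (isOpen_extChartAt_target (I := 𝓡 m) p) (contDiffOn_chartFrame hX p)
    (fun z hz ↦ chartFrame_injective hli hz) i hinv (mem_extChartAt_target p)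
  -- The splitting of the model space into the image of `j` and the kernel of `P`, which gives the
  -- slice its complement.
  let L : (EuclideanSpace ℝ (Fin n) × LinearMap.ker P.toLinearMap) ≃L[ℝ]
      EuclideanSpace ℝ (Fin m) := ContinuousLinearEquiv.equivOfInverse
    (j.coprod (LinearMap.ker P.toLinearMap).subtypeL)
    (P.prod ((ContinuousLinearMap.id ℝ _ - j.comp P).codRestrict _ fun z ↦ by simp [hPj]))
    (by
      rintro ⟨x, k, hk⟩
      have hk' : P k = 0 := hk
      ext1
      · simp [hPj, hk']
      · ext1
        simp [hPj, hk'])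
    (fun z ↦ by simp)
  have hL : ∀ x, L (x, 0) = j x := fun x ↦ by simp [L]
  set τ := straighten P j hPj f (extChartAt (𝓡 m) p p) hfs.continuousOn hPf with hτ
  have hτsymm : ∀ x, τ.symm (j x) = f x := fun x ↦ by
    change j x - j (P (j x)) + f (P (j x)) = f x
    rw [hPj, sub_self, zero_add]
  have hτtarget : ∀ x ∈ ball (0 : EuclideanSpace ℝ (Fin n)) r, j x ∈ τ.target := fun x hx ↦ by
    change P (j x) ∈ ball 0 r
    rwa [hPj]
  -- In this chart the solution `f` becomes the linear slice `x ↦ j x = L (x, 0)`.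
  set κ := (chartAt (EuclideanSpace ℝ (Fin m)) p).trans τ with hκd
  have hκ : κ ∈ maximalAtlas (𝓡 m) ∞ S := by
    refine OpenPartialHomeomorph.mem_maximalAtlas_of_contMDiffOn _ ?_ ?_
    · exact (contMDiffOn_iff_contDiffOn.2 (contDiffOn_straighten hPj hfs hPf)).comp
        (contMDiffOn_chart.mono fun q hq ↦ hq.1) fun q hq ↦ hq.2
    · exact contMDiffOn_chart_symm.comp ((contMDiffOn_iff_contDiffOn.2
        (contDiffOn_straighten_symm hPj hfs hPf)).mono fun q hq ↦ hq.1) fun q hq ↦ hq.2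
  have hκsymm : ∀ x, κ.symm (L (x, 0)) = (extChartAt (𝓡 m) p).symm (f x) := fun x ↦ by
    rw [hL, ← hτsymm]
    rfl
  obtain ⟨M, cs, hM, hmem, hsub, htan⟩ := exists_slice (L := L) hκ isOpen_ball
    (nonempty_ball.2 hr) fun x hx ↦ by
      rw [hL, hκd, OpenPartialHomeomorph.trans_target]
      refine ⟨hτtarget x hx, ?_⟩
      have := hfU x hx
      rw [← hτsymm] at this
      simpa using this
  refine ⟨M, cs, hM, ?_, hsub, fun q ↦ ?_⟩
  · have := hmem 0 (mem_ball_self hr)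
    rwa [hκsymm, hf0, extChartAt_to_inv] at this
  · obtain ⟨x, hx, hxq, hT⟩ := htan q
    have hfd : DifferentiableAt ℝ f x :=
      (hfs.differentiableOn (by simp)).differentiableAt (isOpen_ball.mem_nhds hx)
    have hcomp := mfderiv_comp x ((contMDiffAt_chart_symm (hfU x hx)).mdifferentiableAt (by simp))
      hfd.mdifferentiableAt
    rw [mfderiv_eq_fderiv] at hcomp
    have hfun : (fun x ↦ κ.symm (L (x, 0))) = (extChartAt (𝓡 m) p).symm ∘ f := funext hκsymm
    rw [hT, hfun]
    rw [hκsymm] at hxq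
    have hgoal : LinearMap.range
        (mfderiv (𝓡 n) (𝓡 m) ((extChartAt (𝓡 m) p).symm ∘ f) x).toLinearMap =
          V ((extChartAt (𝓡 m) p).symm (f x)) := by
      rw [hV₀]
      apply le_antisymm
      · rintro _ ⟨a, rfl⟩
        obtain ⟨c, hc, hce⟩ := (hrange x hx).le ⟨a, rfl⟩
        refine ⟨c, hc, ?_⟩
        refine (mfderiv_chartFrame (hfU x hx) c).symm.trans ?_
        refine Eq.trans ?_ (DFunLike.congr_fun hcomp a).symm
        exact congrArg _ hce
      · rintro _ ⟨c, hc, rfl⟩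
        obtain ⟨a, ha⟩ := (hrange x hx).ge ⟨c, hc, rfl⟩
        refine ⟨a, ?_⟩
        refine Eq.trans ?_ (mfderiv_chartFrame (hfU x hx) c)
        refine (DFunLike.congr_fun hcomp a).trans ?_
        exact congrArg _ ha
    obtain ⟨q, hq⟩ := q
    obtain rfl : (extChartAt (𝓡 m) p).symm (f x) = q := hxq
    exact hgoal

end IntegralManifold

end AutoparallelDist

end

/-! ### The equivalence of the four conditions. -/

theorem mainTheorem5 {m n : ℕ} {S : Type*} [TopologicalSpace S] [T2Space S]
    [SecondCountableTopology S] [ConnectedSpace S]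
    [ChartedSpace (EuclideanSpace ℝ (Fin m)) S] [IsManifold (𝓡 m) ∞ S]
    (cov : AutoparallelDist.AffineConnection m S) [CovariantDerivative.ContMDiffCovariantDerivative cov ∞]
    (hcov : AutoparallelDist.IsCurvatureFree cov)
    (V : Π p : S, Submodule ℝ (TangentSpace (𝓡 m) p))
    (hn : ∀ p, Module.finrank ℝ (V p) = n)
    (hV : AutoparallelDist.IsParallelDistribution cov V) :
    List.TFAE [
      ∀ p : S, ∃ (M : Set S) (_ : ChartedSpace (EuclideanSpace ℝ (Fin n)) M)
        (_ : IsManifold (𝓡 n) ∞ M) (hp : p ∈ M),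
        AutoparallelDist.IsSubmanifold m n M ∧ AutoparallelDist.IsAutoparallel cov n M ∧
          AutoparallelDist.tangentOf m n M ⟨p, hp⟩ = V p,
      ∀ X ∈ AutoparallelDist.smoothVFIn V, ∀ Y ∈ AutoparallelDist.smoothVFIn V,
        VectorField.mlieBracket (𝓡 m) X Y ∈ AutoparallelDist.smoothVFIn V,
      ∀ X ∈ AutoparallelDist.parallelVFIn cov V, ∀ Y ∈ AutoparallelDist.parallelVFIn cov V,
        VectorField.mlieBracket (𝓡 m) X Y ∈ AutoparallelDist.smoothVFIn V,
      ∀ p : S, ∀ u ∈ V p, ∀ v ∈ V p, cov.torsion p u v ∈ V p] := by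
  open AutoparallelDist in
  obtain ⟨X, hX, hli⟩ := hcov
  obtain ⟨V₀, hV₀⟩ := exists_eq_map_frameMap hX hli hV
  tfae_have 1 → 4 := fun h p u hu v hv ↦ by
    obtain ⟨M, _, _, hp, hM, ha, hT⟩ := h p
    rw [← hT] at hu hv ⊢
    exact torsion_mem_tangentOf hM ha ⟨p, hp⟩ hu hv
  tfae_have 4 → 2 := fun h Y hY Z hZ ↦ bracket_mem_of_torsion_mem hX hli hV₀ h hY hZ
  tfae_have 2 → 3 := fun h Y hY Z hZ ↦ h Y hY.1 Z hZ.1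
  tfae_have 3 → 1 := fun h p ↦ by
    obtain ⟨M, _, _, hp, hM, hT⟩ := exists_integral_manifold hX hli hV₀ hn h p
    exact ⟨M, _, _, hp, hM, isAutoparallel_of_tangentOf_eq hX hli hV₀ hM hT, hT ⟨p, hp⟩⟩
  tfae_finish
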